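/- Let $n,T$ be natural numbers and $N=\{1,\dots,n\}$. A weighted network is a symmetric $n\times n$ matrix $\mathbf G=(g_{ij})$ with $g_{ij}\in[0,1]$ and $g_{ii}=0$. A weighted network $\hat{\mathbf G}$ succeeds $\mathbf G$ if $\hat{\mathbf G}=\mathbf G+\mathbf W$ for a symmetric matrix $\mathbf W\ge \mathbf 0$ with $\mathbf 1'\mathbf W\mathbf 1=2$ (one unit of weight is added). A feasible path is a sequence $\mathbf s=(\mathbf G(t))_{t=1}^T$ of weighted networks such that $\mathbf G(t)$ succeeds $\mathbf G(t-1)$ for $t=1,\dots,T$, where $\mathbf G(0)=\mathbf 0$; $S_w$ is the set of feasible paths. Fix $\phi>0$ such that $\phi\,\lambda_{\max}(\mathbf G(t))<1$ for all $(\mathbf G(t))_{t=1}^T\in S_w$ and all $t$. Let $b_i(\mathbf G)=\sum_{k\ge0}\phi^k\,\mathbf 1'\mathbf G^k\mathbf e_i$ be the Katz--Bonacich centrality of node $i$ and $b^{[2]}(\mathbf G)=\sum_{i\in N}b_i(\mathbf G)^2$. For a discount function $D:\{1,\dots,T\}\to[0,1]$ consider the problem $$\max_{(\mathbf G(t))_{t=1}^T\in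 S_w}\ \sum_{t=1}^T D(t)\,b^{[2]}(\mathbf G(t)).\qquad(\ast)$$ (i) For every discount function $D$, every solution $(\mathbf G^*(t))_{t=1}^T$ of $(\ast)$ and every $t$ with $D(t)>0$: $\mathbf G^*(t)$ is a weighted nested split graph, that is, for any two distinct nodes $i,j$, either $g^*_{ik}(t)\ge g^*_{jk}(t)$ for all $k\notin\{i,j\}$, or $g^*_{jk}(t)\ge g^*_{ik}(t)$ for all $k\notin\{i,j\}$. Moreover, there are no node $i$ and two distinct nodes $j,k$ such that both $g^*_{ij}(t)$ and $g^*_{ik}(t)$ belong to $(0,1)$. (ii) When the planner is myopic, the optimal network $\mathbf G^*(t)$ is, for every $t=1,\dots,T$, the unweighted quasi-complete graph with $t$ links: all weights are $0$ or $1$, the links are those of a clique on $p$ nodes, where $\frac{p(p-1)}2\le t<\frac{p(p+1)}2$, together with $t-\frac{p(p-1)}2$ links between one further node and nodes of the clique. This holds in both of the following senses. (a) Let $\succ$ be any strict preference relation on paths that is myopic: whenever $\mathbf s=(\mathbf G(t))_t$ and $\hat{\mathbf s}=(\hat{\mathbf G}(t))_t$ are feasible paths, $t'$ is the first period at which $b^{[2]}(\mathbf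 G(t'))\ne b^{[2]}(\hat{\mathbf G}(t'))$, and $b^{[2]}(\mathbf G(t'))>b^{[2]}(\hat{\mathbf G}(t'))$, then $\mathbf s\succ\hat{\mathbf s}$. Then every feasible path to which no feasible path is strictly preferred forms the quasi-complete graph with $t$ links in each period $t$. (b) There is $\varepsilon>0$, depending only on $n,T,\phi$, such that for every discount function $D$ with $D(t)>0$ for all $t\le T$ and $D(t+1)/D(t)<\varepsilon$ for all $1\le t<T$, every solution of $(\ast)$ forms the quasi-complete graph with $t$ links in each period $t$. -/

import Mathlib

open scoped BigOperators

namespace SeqNet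

/-- A square matrix of link weights on the node set `{0, …, n - 1}`. -/
abbrev Network (n : ℕ) := Matrix (Fin n) (Fin n) ℝ

/-- The weighted undirected networks: symmetric, zero diagonal, weights in `[0, 1]`. -/
def weightedNetworks (n : ℕ) : Set (Network n) :=
  {G | ∀ i j, G i j = G j i ∧ G i j ∈ Set.Icc (0 : ℝ) 1 ∧ G i i = 0}

/-- The networks that succeed `G`: one unit of weight is added, spread over the pairs of nodes.
The unit counts twice in the sum of all entries, by symmetry. -/
def successors {n : ℕ} (G : Network n) : Set (Network n) :=
  {G' | G' ∈ weightedNetworks n ∧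
    ∃ W : Network n, (∀ i j, 0 ≤ W i j) ∧ W.transpose = W ∧ (∑ i, ∑ j, W i j) = 2 ∧ G' = G + W}

/-- The feasible formation paths over the periods `1, …, T`, starting from the empty network at
time `0`. The values `s t` with `t > T` play no role. -/
def feasiblePaths (n T : ℕ) : Set (ℕ → Network n) :=
  {s | s 0 = 0 ∧ ∀ t ∈ Finset.Icc 1 T, s t ∈ successors (s (t - 1))}

/-- Katz-Bonacich centrality `∑ₖ φ ^ k 𝟏ᵀ G ^ k eᵢ` of node `i`. -/
noncomputable def kb {n : ℕ} (φ : ℝ) (G : Network n) (i : Fin n) : ℝ :=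
  ∑' k : ℕ, φ ^ k * ∑ j, (G ^ k) j i

/-- The sum of the squares of the Katz-Bonacich centralities. -/
noncomputable def kbSq {n : ℕ} (φ : ℝ) (G : Network n) : ℝ :=
  ∑ i, kb φ G i ^ 2

/-- The discounted sum of the instantaneous utilities `kbSq` over the periods `1, …, T`. -/
noncomputable def payoff {n : ℕ} (φ : ℝ) (T : ℕ) (D : ℕ → ℝ) (s : ℕ → Network n) : ℝ :=
  ∑ t ∈ Finset.Icc 1 T, D t * kbSq φ (s t)

/-- The path `s` solves the planner's problem of maximizing `payoff` over the feasible paths. -/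
def IsSolution {n : ℕ} (φ : ℝ) (T : ℕ) (D : ℕ → ℝ) (s : ℕ → Network n) : Prop :=
  s ∈ feasiblePaths n T ∧ IsMaxOn (payoff φ T D) (feasiblePaths n T) s

/-- Weighted nested split graph. -/
def IsWeightedNSG {n : ℕ} (G : Network n) : Prop :=
  ∀ i j : Fin n, i ≠ j →
    (∀ k, k ≠ i → k ≠ j → G j k ≤ G i k) ∨ (∀ k, k ≠ i → k ≠ j → G i k ≤ G j k)

open Classical in
/-- `G` is an (unweighted) quasi-complete graph with `t` links: a clique `K` of `p` nodes, where
`p (p - 1) / 2 ≤ t < p (p + 1) / 2`, and the remaining `t - p (p - 1) / 2` links join one node `q`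
outside `K` with the nodes of a subset `R` of `K`. If no link remains, then `R` is empty and
the choice of `q` is immaterial. -/
def IsQuasiComplete {n : ℕ} (t : ℕ) (G : Network n) : Prop :=
  ∃ (K R : Finset (Fin n)) (q : Fin n),
    R ⊆ K ∧ (R.Nonempty → q ∉ K) ∧
    K.card.choose 2 ≤ t ∧ t < (K.card + 1).choose 2 ∧ K.card.choose 2 + R.card = t ∧
    ∀ i j, G i j =
      if i ≠ j ∧ ((i ∈ K ∧ j ∈ K) ∨ (i = q ∧ j ∈ R) ∨ (i ∈ R ∧ j = q)) then 1 else 0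

/-- A strict preference `pref` on paths (`pref s s'` says that `s` is strictly preferred to `s'`)
is myopic if, of two feasible paths, it prefers the one with the larger instantaneous utility
at the first period at which the two instantaneous utilities differ. -/
def IsMyopic {n : ℕ} (φ : ℝ) (T : ℕ) (pref : (ℕ → Network n) → (ℕ → Network n) → Prop) : Prop :=
  ∀ s ∈ feasiblePaths n T, ∀ s' ∈ feasiblePaths n T, ∀ t ∈ Finset.Icc 1 T,
    (∀ r ∈ Finset.Icc 1 T, r < t → kbSq φ (s r) = kbSq φ (s' r)) →
    kbSq φ (s' t) < kbSq φ (s t) → pref s s'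

end SeqNet

/-! Since `φ` times every eigenvalue is below one, `1 - φG` is positive definite, and as `G ≥ 0` a
comparison principle holds: any `x ≤ 𝟏 + φGx` lies below the centrality vector `b`
(`Subcritical.le_kb`). Every lower bound on centralities after a change of the network comes from an
explicit sub-solution, never from the walk series itself.

Part (i): for two nodes `i`, `j`, push as much weight as fits from each link `jl` to `il`, in all
periods at once. The new weights `min 1 (g_il + g_jl)` and `max 0 (g_il + g_jl - 1)` are monotone in
the old ones, so the path stays feasible. The vector `b + η(e_i - e_j)` is a sub-solution for a
suitable `η`, and a majorization inequality shows that no period loses, with a strict gain unless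
the network already ranks the two nodes (`Subcritical.kbSq_lt_shift`). Optimal networks are
therefore `StronglyNested`, which implies both claims of (i).

Part (ii) is an induction on periods. A unit added to a quasi-complete graph with a strongly nested
result either yields the next quasi-complete graph, or is split between the next link `qk` and a
pendant link `zm` of weight `β` (`IsQuasiComplete.succ_or_hasPendant`). Moving the pendant weight to
`qk` changes nothing earlier and gains at least `φ³/(1+φ) · β` now (`HasPendant.kbSq_add_le`).
Myopic preferences exclude the pendant at once. Under discounting, the later losses are at most a
constant times `β`, by compactness of the set of paths and a Lipschitz bound, so one `ε` serves for
all `β`. -/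

namespace SeqNet

/-! ### Positive definiteness, the comparison principle and the linear system for centralities. -/

open Matrix

variable {n : ℕ} {φ : ℝ} {G G' : Network n}

/-- Weighted networks all of whose eigenvalues lie below `1 / φ`. -/
structure Subcritical (φ : ℝ) (G : Network n) : Prop where
  pos : 0 < φ
  mem : G ∈ weightedNetworks n
  spec : ∀ ev ∈ spectrum ℝ G, φ * ev < 1

namespace Subcritical

lemma symm (h : Subcritical φ G) (i j : Fin n) : G i j = G j i := (h.mem i j).1

lemma nonneg (h : Subcritical φ G) (i j : Fin n) : 0 ≤ G i j := (h.mem i j).2.1.1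

lemma diag (h : Subcritical φ G) (i : Fin n) : G i i = 0 := (h.mem i i).2.2

lemma isHermitian (h : Subcritical φ G) : G.IsHermitian := by
  ext i j
  simp [Matrix.conjTranspose_apply, h.symm i j]

lemma posDef (h : Subcritical φ G) : (1 - φ • G).PosDef := by
  have hH : (1 - φ • G).IsHermitian := by
    ext i j
    simp [Matrix.conjTranspose_apply, h.symm i j, Matrix.one_apply, eq_comm]
  rw [hH.posDef_iff_eigenvalues_pos]
  intro i
  have hm := hH.eigenvalues_mem_spectrum_real i
  set μ := hH.eigenvalues i
  have key : (1 - μ) / φ ∈ spectrum ℝ G := by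
    rw [spectrum.mem_iff] at hm ⊢
    intro hu
    apply hm
    have e : algebraMap ℝ (Network n) μ - (1 - φ • G)
        = (-φ) • (algebraMap ℝ (Network n) ((1 - μ) / φ) - G) := by
      simp only [Algebra.algebraMap_eq_smul_one, smul_sub, smul_smul]
      have : -φ * ((1 - μ) / φ) = μ - 1 := by field_simp [h.pos.ne']; ring
      rw [this, sub_smul, neg_smul, one_smul]
      abel
    rw [e]
    exact hu.smul (Units.mk0 (-φ) (neg_ne_zero.2 h.pos.ne'))
  have := h.spec _ key
  rw [mul_div_cancel₀ _ h.pos.ne'] at this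
  linarith

lemma quadratic_lt (h : Subcritical φ G) {x : Fin n → ℝ} (hx : x ≠ 0) :
    φ * ∑ i, x i * ∑ j, G i j * x j < ∑ i, x i * x i := by
  have := h.posDef.dotProduct_mulVec_pos hx
  simp only [Matrix.sub_mulVec, Matrix.one_mulVec, Matrix.smul_mulVec, dotProduct_sub,
    star_trivial, dotProduct_smul, smul_eq_mul] at this
  simp only [dotProduct, mulVec] at this
  linarith

/-- A super-solution of the homogeneous equation is nonnegative. -/
lemma nonneg_of_le (h : Subcritical φ G) {y : Fin n → ℝ}
    (hy : ∀ i, φ * ∑ j, G i j * y j ≤ y i) (i : Fin n) : 0 ≤ y i := by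
  by_contra hi
  push Not at hi
  -- The negative part `x` of `y` satisfies `x_k ≤ φ(Gx)_k` wherever `x_k > 0`, because `G ≥ 0`.
  -- Pairing with `x` contradicts positive definiteness.
  set x : Fin n → ℝ := fun i => max (-y i) 0 with hx
  have hx0 : x ≠ 0 := by
    intro h0
    have := congrFun h0 i
    simp only [hx, Pi.zero_apply] at this
    have := le_max_left (-y i) 0
    linarith
  have := h.quadratic_lt hx0
  refine absurd this (not_lt.2 ?_)
  rw [Finset.mul_sum]
  refine Finset.sum_le_sum fun k _ => ?_
  rcases le_or_gt 0 (y k) with hk | hk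
  · have : x k = 0 := by simp [hx, hk]
    simp [this]
  · have hxk : x k = -y k := by simp [hx, hk.le]
    have hxp : 0 < x k := by rw [hxk]; linarith
    have h1 : ∑ j, G k j * (-y j) ≤ ∑ j, G k j * x j :=
      Finset.sum_le_sum fun j _ => mul_le_mul_of_nonneg_left (le_max_left _ _) (h.nonneg k j)
    have h2 := hy k
    have h3 : ∑ j, G k j * (-y j) = -∑ j, G k j * y j := by simp
    have h4 : φ * -∑ j, G k j * y j ≤ φ * ∑ j, G k j * x j := by
      rw [← h3]; exact mul_le_mul_of_nonneg_left h1 h.pos.le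
    have h5 : x k ≤ φ * ∑ j, G k j * x j := by rw [hxk]; linarith
    calc x k * x k ≤ x k * (φ * ∑ j, G k j * x j) := mul_le_mul_of_nonneg_left h5 hxp.le
      _ = _ := by ring

/-- The spectral hypothesis bounds eigenvalues only from above, while convergence of the walk series
needs their modulus. For an eigenvector `v`, nonnegativity of `G` gives `|λ||v| ≤ G|v|` entrywise,
so the quadratic form at `|v|` bounds `|λ|`. -/
lemma abs_eigenvalue_lt (h : Subcritical φ G) (i : Fin n) :
    |φ * h.isHermitian.eigenvalues i| < 1 := by
  set v : Fin n → ℝ := ⇑(h.isHermitian.eigenvectorBasis i) with hv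
  set ev := h.isHermitian.eigenvalues i
  have hGv : G *ᵥ v = ev • v := h.isHermitian.mulVec_eigenvectorBasis i
  set x : Fin n → ℝ := fun a => |v a| with hx
  have hv0 : v ≠ 0 := by
    intro h0
    apply h.isHermitian.eigenvectorBasis.orthonormal.ne_zero i
    ext a
    exact congrFun h0 a
  have hx0 : x ≠ 0 := by
    intro h0
    apply hv0
    ext a
    have := congrFun h0 a
    simpa [hx] using this
  have hq := h.quadratic_lt hx0
  have hle : |ev| * ∑ a, x a * x a ≤ ∑ a, x a * ∑ b, G a b * x b := by
    rw [Finset.mul_sum]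
    refine Finset.sum_le_sum fun a _ => ?_
    have h1 : |ev| * x a ≤ ∑ b, G a b * x b := by
      have h2 := congrFun hGv a
      simp only [mulVec, dotProduct, Pi.smul_apply, smul_eq_mul] at h2
      rw [hx, ← abs_mul, ← h2]
      refine (Finset.abs_sum_le_sum_abs _ _).trans (le_of_eq ?_)
      refine Finset.sum_congr rfl fun b _ => ?_
      rw [abs_mul, abs_of_nonneg (h.nonneg a b)]
    calc |ev| * (x a * x a) = x a * (|ev| * x a) := by ring
      _ ≤ _ := mul_le_mul_of_nonneg_left h1 (abs_nonneg _)
  have hpos : 0 < ∑ a, x a * x a := by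
    obtain ⟨a, ha⟩ := Function.ne_iff.1 hx0
    exact Finset.sum_pos' (fun b _ => mul_self_nonneg _)
      ⟨a, Finset.mem_univ _, mul_self_pos.2 ha⟩
  rw [abs_mul, abs_of_pos h.pos]
  have := mul_le_mul_of_nonneg_left hle h.pos.le
  by_contra hc
  push Not at hc
  nlinarith

lemma summable_pow (h : Subcritical φ G) (i j : Fin n) :
    Summable fun k : ℕ => φ ^ k * (G ^ k) i j := by
  have hH := h.isHermitian
  set U := hH.eigenvectorUnitary
  have hpow : ∀ k : ℕ, G ^ k =
      (U : Network n) * (diagonal fun l => hH.eigenvalues l ^ k) * (star U : Network n) := by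
    intro k
    have e := congrArg (· ^ k) hH.spectral_theorem
    simp only [← map_pow, diagonal_pow] at e
    rw [e, Unitary.conjStarAlgAut_apply]
    rfl
  have hterm : ∀ k : ℕ, φ ^ k * (G ^ k) i j =
      ∑ l, (U : Network n) i l * (star U : Network n) l j * (φ * hH.eigenvalues l) ^ k := by
    intro k
    rw [hpow, Matrix.mul_apply, Finset.mul_sum]
    refine Finset.sum_congr rfl fun l _ => ?_
    rw [Matrix.mul_diagonal, mul_pow]
    ring
  simp only [hterm]
  exact summable_sum fun l _ =>
    (summable_geometric_of_abs_lt_one (h.abs_eigenvalue_lt l)).mul_left _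

/-- The centralities solve the linear system `b = 𝟏 + φ G b`. -/
lemma kb_eq (h : Subcritical φ G) (i : Fin n) :
    kb φ G i = 1 + φ * ∑ j, G i j * kb φ G j := by
  have hs : ∀ i, Summable fun k : ℕ => φ ^ k * ∑ j, (G ^ k) j i := by
    intro i
    simp only [Finset.mul_sum]
    exact summable_sum fun j _ => h.summable_pow j i
  unfold kb
  rw [(hs i).tsum_eq_zero_add]
  congr 1
  · simp [Matrix.one_apply]
  · have e : ∀ j, G i j * ∑' k : ℕ, φ ^ k * ∑ l, (G ^ k) l j
        = ∑' k : ℕ, G i j * (φ ^ k * ∑ l, (G ^ k) l j) := fun j => tsum_mul_left.symm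
    simp only [e]
    rw [← Summable.tsum_finsetSum fun j _ => (hs j).mul_left _, ← tsum_mul_left]
    refine tsum_congr fun k => ?_
    have e2 : ∀ j, (G ^ (k + 1)) j i = ∑ l, G i l * (G ^ k) j l := by
      intro j
      rw [pow_succ, Matrix.mul_apply]
      exact Finset.sum_congr rfl fun l _ => by rw [h.symm i l]; ring
    simp only [e2, Finset.mul_sum]
    rw [Finset.sum_comm]
    exact Finset.sum_congr rfl fun l _ => Finset.sum_congr rfl fun j _ => by ring

/-- Sub-solutions lie below the centralities. -/
lemma le_kb (h : Subcritical φ G) {x : Fin n → ℝ}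
    (hx : ∀ i, x i ≤ 1 + φ * ∑ j, G i j * x j) (i : Fin n) : x i ≤ kb φ G i := by
  have := h.nonneg_of_le (y := fun i => kb φ G i - x i) (fun k => by
    have h1 := h.kb_eq k
    have h2 := hx k
    simp only [mul_sub, Finset.sum_sub_distrib]
    linarith) i
  linarith

lemma kb_nonneg (h : Subcritical φ G) (i : Fin n) : 0 ≤ kb φ G i :=
  h.le_kb (x := fun _ => 0) (fun i => by simp) i

lemma one_le_kb (h : Subcritical φ G) (i : Fin n) : 1 ≤ kb φ G i := by
  rw [h.kb_eq i]
  have := Finset.sum_nonneg fun j (_ : j ∈ Finset.univ) => mul_nonneg (h.nonneg i j) (h.kb_nonneg j)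
  nlinarith [h.pos]

/-- Perturbation bound for the centralities. -/
lemma abs_kb_sub_le (h : Subcritical φ G) (h' : Subcritical φ G') {η : ℝ}
    (hη : ∀ i, |∑ j, (G' i j - G i j) * kb φ G j| ≤ η) (i : Fin n) :
    |kb φ G' i - kb φ G i| ≤ φ * η * kb φ G' i := by
  -- Write `b`, `b'` for the two centrality vectors. Since `(1 - φG')(b' - b) = φ(G' - G)b` is at
  -- most `φη` in modulus and `(1 - φG')b' = 𝟏`, both vectors `φηb' ± (b' - b)` are super-solutions
  -- for `G'`.
  have key : ∀ σ : ℝ, |σ| = 1 → 0 ≤ φ * η * kb φ G' i + σ * (kb φ G' i - kb φ G i) := by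
    intro σ hσ
    refine h'.nonneg_of_le (y := fun i => φ * η * kb φ G' i + σ * (kb φ G' i - kb φ G i))
      (fun k => ?_) i
    have e : ∑ j, G' k j * (φ * η * kb φ G' j + σ * (kb φ G' j - kb φ G j))
        = (φ * η + σ) * ∑ j, G' k j * kb φ G' j - σ * (∑ j, (G' k j - G k j) * kb φ G j)
          - σ * ∑ j, G k j * kb φ G j := by
      simp only [Finset.mul_sum, ← Finset.sum_sub_distrib]
      exact Finset.sum_congr rfl fun j _ => by ring
    have h1 := h'.kb_eq k
    have h2 := h.kb_eq k
    have h3 : -(σ * (∑ j, (G' k j - G k j) * kb φ G j)) ≤ η := by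
      refine (neg_le_abs _).trans ?_
      rw [abs_mul, hσ, one_mul]
      exact hη k
    have h4 := mul_le_mul_of_nonneg_left h3 h.pos.le
    rw [e]
    generalize ∑ j, (G' k j - G k j) * kb φ G j = A at *
    generalize ∑ j, G k j * kb φ G j = B at *
    generalize ∑ j, G' k j * kb φ G' j = C at *
    rw [h1, h2]
    nlinarith
  rw [abs_le]
  constructor
  · have := key 1 (by simp)
    linarith
  · have := key (-1) (by simp)
    linarith

end Subcritical

end SeqNet

/-! ### Shifting weight between two nodes: effect on the centralities. -/

namespace SeqNet

variable {n : ℕ} {φ : ℝ} {G G' : Network n}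

/-- The perturbation that moves, for every node `l`, the weight `δ l` from the link `jl` to the
link `il`. -/
def shift (i j : Fin n) (δ : Fin n → ℝ) : Network n := fun a b =>
  ((Pi.single i 1 : Fin n → ℝ) a - (Pi.single j 1 : Fin n → ℝ) a) * δ b +
    δ a * ((Pi.single i 1 : Fin n → ℝ) b - (Pi.single j 1 : Fin n → ℝ) b)

lemma shift_symm (i j : Fin n) (δ : Fin n → ℝ) (a b : Fin n) :
    shift i j δ a b = shift i j δ b a := by
  simp only [shift]; ring

lemma sum_shift_mul (i j : Fin n) (δ x : Fin n → ℝ) (a : Fin n) :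
    ∑ b, shift i j δ a b * x b =
      ((Pi.single i 1 : Fin n → ℝ) a - (Pi.single j 1 : Fin n → ℝ) a) * ∑ b, δ b * x b +
        δ a * (x i - x j) := by
  simp only [shift, add_mul, Finset.sum_add_distrib, Finset.mul_sum, mul_assoc, sub_mul,
    Finset.sum_sub_distrib]
  simp [mul_sub, Pi.single_apply]

lemma sum_sum_shift (i j : Fin n) (δ : Fin n → ℝ) : ∑ a, ∑ b, shift i j δ a b = 0 := by
  have h : ∀ a, ∑ b, shift i j δ a b =
      ((Pi.single i 1 : Fin n → ℝ) a - (Pi.single j 1 : Fin n → ℝ) a) * ∑ b, δ b := by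
    intro a
    simpa using sum_shift_mul i j δ (fun _ => 1) a
  simp [h, ← Finset.sum_mul]

/-- This is weak majorization: `a'` is at least both `a` and `b`, and the sum does not fall, so the
sum of squares does not fall either. -/
lemma sq_add_sq_le_of_majorize {a b a' b' η : ℝ} (ha : 0 ≤ a) (hb : 0 ≤ b) (hb' : 0 ≤ b')
    (hη : 0 ≤ η) (hba : b ≤ a + η) (h1 : a + η ≤ a') (h2 : a + b ≤ a' + b') :
    a ^ 2 + b ^ 2 ≤ a' ^ 2 + b' ^ 2 := by
  rcases le_or_gt b b' with h | h
  · nlinarith [pow_le_pow_left₀ hb h 2, pow_le_pow_left₀ ha (by linarith : a ≤ a') 2]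
  · nlinarith [mul_nonneg (sub_nonneg.2 h.le) (sub_nonneg.2 (hba.trans h1)),
      mul_nonneg (sub_nonneg.2 h2) (by linarith : (0:ℝ) ≤ a' + a)]

lemma sq_add_sq_lt_of_majorize {a b a' b' η : ℝ} (ha : 0 < a) (hb : 0 ≤ b) (hb' : 0 ≤ b')
    (hη : 0 < η) (hba : b < a + η) (h1 : a + η ≤ a') (h2 : a + b ≤ a' + b') :
    a ^ 2 + b ^ 2 < a' ^ 2 + b' ^ 2 := by
  rcases le_or_gt b b' with h | h
  · nlinarith [pow_le_pow_left₀ hb h 2,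
      pow_lt_pow_left₀ (by linarith : a < a') ha.le two_ne_zero]
  · nlinarith [mul_pos (sub_pos.2 h) (sub_pos.2 (hba.trans_le h1)),
      mul_nonneg (sub_nonneg.2 h2) (by linarith : (0:ℝ) ≤ a' + a)]

namespace Subcritical

/-- Shifting weights from `j` to `i` in such a way that `i` dominates `j` afterwards. -/
lemma kb_shift_bounds (h : Subcritical φ G) (h' : Subcritical φ G') {i j : Fin n} (hij : i ≠ j)
    {δ : Fin n → ℝ} (hG : G' = G + shift i j δ) (hi : δ i = 0) (hj : δ j = 0)
    (h0 : ∀ l, 0 ≤ δ l) (h1 : ∀ l, l ≠ i → l ≠ j → G j l - G i l ≤ δ l) :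
    ∃ η, 0 ≤ η ∧ kb φ G j ≤ kb φ G i + η ∧ kb φ G i + η ≤ kb φ G' i ∧
      kb φ G j - η ≤ kb φ G' j ∧ (∀ l, l ≠ i → l ≠ j → kb φ G l ≤ kb φ G' l) ∧
      ((∃ l, 0 < δ l) → 0 < η) ∧
      ((∃ l, l ≠ i ∧ l ≠ j ∧ G j l - G i l < δ l) → kb φ G j < kb φ G i + η) := by
  set b := kb φ G with hb
  have hφ := h.pos
  have hb1 : ∀ l, 0 < b l := fun l => zero_lt_one.trans_le (h.one_le_kb l)
  have hw : 0 < 1 + φ * G i j := by nlinarith [h.nonneg i j]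
  set S := ∑ l, δ l * b l with hS
  have hS0 : 0 ≤ S := Finset.sum_nonneg fun l _ => mul_nonneg (h0 l) (hb1 l).le
  -- This value makes `b + η(e_i - e_j)` satisfy the rows `i` and `j` of the system for `G'` with
  -- equality. The denominator accounts for the feedback through the link `ij`, which the shift does
  -- not touch.
  set η := φ * S / (1 + φ * G i j) with hη
  have hηe : (1 + φ * G i j) * η = φ * S := by rw [hη]; field_simp
  have hη0 : 0 ≤ η := div_nonneg (mul_nonneg hφ.le hS0) hw.le
  -- the difference of the two centralities
  have hdiff : (1 + φ * G i j) * (b j - b i) =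
      φ * ∑ l, (if l = i ∨ l = j then 0 else (G j l - G i l) * b l) := by
    have e : ∑ l, (if l = i ∨ l = j then 0 else (G j l - G i l) * b l) =
        (∑ l, G j l * b l) - (∑ l, G i l * b l) - G i j * b i + G i j * b j := by
      have : ∀ l, (if l = i ∨ l = j then 0 else (G j l - G i l) * b l) =
          G j l * b l - G i l * b l - (if l = i then G i j * b i else 0)
            + (if l = j then G i j * b j else 0) := by
        intro l
        by_cases hli : l = i
        · subst hli; simp [hij, h.diag, h.symm j l]
        · by_cases hlj : l = j
          · subst hlj; simp [hli, h.diag]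
          · simp [hli, hlj]; ring
      simp only [this, Finset.sum_add_distrib, Finset.sum_sub_distrib]
      simp
    rw [e]
    have := h.kb_eq i
    have := h.kb_eq j
    rw [← hb] at *
    linarith
  have hterm : ∀ l, (if l = i ∨ l = j then 0 else (G j l - G i l) * b l) ≤ δ l * b l := by
    intro l
    split_ifs with hl
    · exact mul_nonneg (h0 l) (hb1 l).le
    · push Not at hl
      exact mul_le_mul_of_nonneg_right (h1 l hl.1 hl.2) (hb1 l).le
  have hji : b j ≤ b i + η := by
    have := mul_le_mul_of_nonneg_left (Finset.sum_le_sum fun l (_ : l ∈ Finset.univ) => hterm l)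
      hφ.le
    rw [← hdiff, ← hS, ← hηe] at this
    have := le_of_mul_le_mul_left this hw
    linarith
  -- the sub-solution
  have hle : ∀ l, b l + η * ((Pi.single i 1 : Fin n → ℝ) l - (Pi.single j 1 : Fin n → ℝ) l)
      ≤ kb φ G' l := by
    apply h'.le_kb
    intro l
    have e : ∑ m, G' l m *
        (b m + η * ((Pi.single i 1 : Fin n → ℝ) m - (Pi.single j 1 : Fin n → ℝ) m)) =
        (∑ m, G l m * b m) + (((Pi.single i 1 : Fin n → ℝ) l - (Pi.single j 1 : Fin n → ℝ) l) * S
          + δ l * (b i - b j)) + η * (G' l i - G' l j) := by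
      rw [hS, ← sum_shift_mul i j δ b l]
      simp only [mul_add, Finset.sum_add_distrib]
      congr 1
      · rw [← Finset.sum_add_distrib]
        exact Finset.sum_congr rfl fun m _ => by rw [hG, Matrix.add_apply]; ring
      · have : ∀ m, G' l m *
            (η * ((Pi.single i 1 : Fin n → ℝ) m - (Pi.single j 1 : Fin n → ℝ) m)) =
            (if m = i then η * G' l m else 0) - (if m = j then η * G' l m else 0) := by
          intro m; simp only [Pi.single_apply]; split_ifs <;> ring
        simp only [this, Finset.sum_sub_distrib]
        simp; ring
    rw [e, mul_add, mul_add]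
    have hk := h.kb_eq l
    rw [← hb] at hk
    have hG'ij : G' i j = G i j := by
      rw [hG, Matrix.add_apply]; simp [shift, hi, hj]
    by_cases hli : l = i
    · subst hli
      simp only [Pi.single_eq_same, Pi.single_eq_of_ne hij, hi, h'.diag, hG'ij]
      linarith
    · by_cases hlj : l = j
      · subst hlj
        simp only [Pi.single_eq_same, Pi.single_eq_of_ne hli, hj, h'.diag, h'.symm l i, hG'ij]
        linarith
      · simp only [Pi.single_eq_of_ne hli, Pi.single_eq_of_ne hlj]
        have e1 : G' l i = G l i + δ l := by
          rw [hG, Matrix.add_apply]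
          simp [shift, hi, hli, hlj, hij]
        have e2 : G' l j = G l j - δ l := by
          rw [hG, Matrix.add_apply]
          simp [shift, hj, hli, hlj, hij.symm]; ring
        have h2 := h1 l hli hlj
        rw [h.symm j l, h.symm i l] at h2
        -- In a row `l` outside the pair, `g'_li - g'_lj = g_li - g_lj + 2δ_l ≥ δ_l`, and `b_i - b_j
        -- ≥ -η`: the gain from the larger weight at `i` covers the deficit.
        have h3 : 0 ≤ δ l * (b i - b j) + η * (G' l i - G' l j) := by
          rw [e1, e2]
          nlinarith [h0 l, mul_nonneg (h0 l) (sub_nonneg.2 hji),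
            mul_nonneg hη0 (sub_nonneg.2 h2)]
        nlinarith
  refine ⟨η, hη0, hji, ?_, ?_, ?_, ?_, ?_⟩
  · simpa [Pi.single_eq_of_ne hij] using hle i
  · have := hle j
    simp only [Pi.single_eq_same, Pi.single_eq_of_ne hij.symm] at this
    linarith
  · intro l hli hlj
    simpa [Pi.single_eq_of_ne hli, Pi.single_eq_of_ne hlj] using hle l
  · rintro ⟨l, hl⟩
    have : 0 < S := Finset.sum_pos' (fun m _ => mul_nonneg (h0 m) (hb1 m).le)
      ⟨l, Finset.mem_univ _, mul_pos hl (hb1 l)⟩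
    exact div_pos (mul_pos hφ this) hw
  · rintro ⟨l, hli, hlj, hl⟩
    have hs : ∑ l, (if l = i ∨ l = j then 0 else (G j l - G i l) * b l) < S := by
      refine Finset.sum_lt_sum (fun l _ => hterm l) ⟨l, Finset.mem_univ _, ?_⟩
      simpa [hli, hlj] using mul_lt_mul_of_pos_right hl (hb1 l)
    have := mul_lt_mul_of_pos_left hs hφ
    rw [← hdiff, ← hηe] at this
    have := lt_of_mul_lt_mul_left this hw.le
    linarith

lemma kbSq_sub_ge (h : Subcritical φ G) {i j : Fin n} (hij : i ≠ j)
    (ho : ∀ l, l ≠ i → l ≠ j → kb φ G l ≤ kb φ G' l) :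
    kb φ G' i ^ 2 + kb φ G' j ^ 2 - (kb φ G i ^ 2 + kb φ G j ^ 2) ≤ kbSq φ G' - kbSq φ G := by
  have e : ∀ H : Network n, kbSq φ H = kb φ H i ^ 2 + kb φ H j ^ 2 +
      ∑ l ∈ (Finset.univ.erase i).erase j, kb φ H l ^ 2 := by
    intro H
    have hj : j ∈ Finset.univ.erase i := by simp [hij.symm]
    rw [kbSq, ← Finset.add_sum_erase _ _ (Finset.mem_univ i), ← Finset.add_sum_erase _ _ hj]
    ring
  rw [e G, e G']
  have : ∑ l ∈ (Finset.univ.erase i).erase j, kb φ G l ^ 2 ≤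
      ∑ l ∈ (Finset.univ.erase i).erase j, kb φ G' l ^ 2 := by
    refine Finset.sum_le_sum fun l hl => ?_
    simp only [Finset.mem_erase, Finset.mem_univ, and_true] at hl
    exact pow_le_pow_left₀ (h.kb_nonneg l) (ho l hl.2 hl.1) 2
  linarith

lemma kbSq_le_shift (h : Subcritical φ G) (h' : Subcritical φ G') {i j : Fin n} (hij : i ≠ j)
    {δ : Fin n → ℝ} (hG : G' = G + shift i j δ) (hi : δ i = 0) (hj : δ j = 0)
    (h0 : ∀ l, 0 ≤ δ l) (h1 : ∀ l, l ≠ i → l ≠ j → G j l - G i l ≤ δ l) :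
    kbSq φ G ≤ kbSq φ G' := by
  obtain ⟨η, hη, h2, h3, h4, h5, -, -⟩ := h.kb_shift_bounds h' hij hG hi hj h0 h1
  have := h.kbSq_sub_ge hij h5
  have := sq_add_sq_le_of_majorize (h.kb_nonneg i) (h.kb_nonneg j) (h'.kb_nonneg j) hη h2 h3
    (by linarith)
  linarith

/-- Both strictness conditions are needed. With `δ = 0` nothing moves, and with `δ_l = g_jl - g_il`
for all other `l` the shift merely exchanges the roles of `i` and `j`. -/
lemma kbSq_lt_shift (h : Subcritical φ G) (h' : Subcritical φ G') {i j : Fin n} (hij : i ≠ j)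
    {δ : Fin n → ℝ} (hG : G' = G + shift i j δ) (hi : δ i = 0) (hj : δ j = 0)
    (h0 : ∀ l, 0 ≤ δ l) (h1 : ∀ l, l ≠ i → l ≠ j → G j l - G i l ≤ δ l)
    (hs0 : ∃ l, 0 < δ l) (hs1 : ∃ l, l ≠ i ∧ l ≠ j ∧ G j l - G i l < δ l) :
    kbSq φ G < kbSq φ G' := by
  obtain ⟨η, -, -, h3, h4, h5, h6, h7⟩ := h.kb_shift_bounds h' hij hG hi hj h0 h1
  have := h.kbSq_sub_ge hij h5
  have := sq_add_sq_lt_of_majorize (zero_lt_one.trans_le (h.one_le_kb i)) (h.kb_nonneg j)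
    (h'.kb_nonneg j) (h6 hs0) (h7 hs1) h3 (by linarith)
  linarith

end Subcritical

end SeqNet

/-! ### Compression of feasible paths and the nested structure of unimprovable networks. -/

namespace SeqNet

variable {n T : ℕ} {φ : ℝ} {G G' : Network n}

lemma mem_successors_iff (hG : G ∈ weightedNetworks n) :
    G' ∈ successors G ↔ G' ∈ weightedNetworks n ∧ (∀ i j, G i j ≤ G' i j) ∧
      ∑ i, ∑ j, G' i j = (∑ i, ∑ j, G i j) + 2 := by
  constructor
  · rintro ⟨h, W, hW, -, hs, rfl⟩
    refine ⟨h, fun i j => ?_, ?_⟩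
    · have := hW i j
      rw [Matrix.add_apply]; linarith
    · simp only [Matrix.add_apply, Finset.sum_add_distrib]
      linarith
  · rintro ⟨h, hle, hs⟩
    refine ⟨h, G' - G, fun i j => by simpa using hle i j, ?_, ?_, by simp⟩
    · ext i j
      simp [(h i j).1, (hG i j).1]
    · simp only [Matrix.sub_apply, Finset.sum_sub_distrib]
      linarith

lemma zero_mem_weightedNetworks : (0 : Network n) ∈ weightedNetworks n := fun i j => by simp

lemma mem_weightedNetworks_of_feasible {s : ℕ → Network n} (hs : s ∈ feasiblePaths n T) {t : ℕ}
    (ht : t ≤ T) : s t ∈ weightedNetworks n := by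
  rcases Nat.eq_zero_or_pos t with rfl | h
  · rw [hs.1]; exact zero_mem_weightedNetworks
  · exact (hs.2 t (Finset.mem_Icc.2 ⟨h, ht⟩)).1

lemma feasible_step {s : ℕ → Network n} (hs : s ∈ feasiblePaths n T) {t : ℕ} (ht : t + 1 ≤ T) :
    (∀ i j, s t i j ≤ s (t + 1) i j) ∧
      ∑ i, ∑ j, s (t + 1) i j = (∑ i, ∑ j, s t i j) + 2 := by
  have := (mem_successors_iff (mem_weightedNetworks_of_feasible hs (t := t) (by omega))).1
    (hs.2 (t + 1) (Finset.mem_Icc.2 ⟨by omega, ht⟩))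
  exact this.2

lemma feasible_mono {s : ℕ → Network n} (hs : s ∈ feasiblePaths n T) {r t : ℕ} (hrt : r ≤ t)
    (ht : t ≤ T) (i j : Fin n) : s r i j ≤ s t i j := by
  induction t, hrt using Nat.le_induction with
  | base => exact le_rfl
  | succ t _ ih => exact (ih (by omega)).trans ((feasible_step hs ht).1 i j)

/-- A transformation of networks that preserves weightedness, the order and the total weight
maps feasible paths to feasible paths. -/
lemma feasible_comp {f : Network n → Network n} (f0 : f 0 = 0)
    (fmem : ∀ G ∈ weightedNetworks n, f G ∈ weightedNetworks n)
    (fmono : ∀ G ∈ weightedNetworks n, ∀ G' ∈ weightedNetworks n,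
      (∀ i j, G i j ≤ G' i j) → ∀ i j, f G i j ≤ f G' i j)
    (fsum : ∀ G, ∑ i, ∑ j, f G i j = ∑ i, ∑ j, G i j)
    {s : ℕ → Network n} (hs : s ∈ feasiblePaths n T) : (fun t => f (s t)) ∈ feasiblePaths n T := by
  refine ⟨by simp [hs.1, f0], fun t ht => ?_⟩
  obtain ⟨h1, hT⟩ := Finset.mem_Icc.1 ht
  obtain ⟨t, rfl⟩ := Nat.exists_eq_add_of_le' h1
  have m0 := mem_weightedNetworks_of_feasible hs (t := t) (by omega)
  have m1 := mem_weightedNetworks_of_feasible hs hT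
  obtain ⟨hle, hsum⟩ := feasible_step hs hT
  rw [Nat.add_sub_cancel, mem_successors_iff (fmem _ m0)]
  exact ⟨fmem _ m1, fmono _ m0 _ m1 hle, by rw [fsum, fsum, hsum]⟩

/-- Move as much of the weight at `j` as fits to the corresponding links at `i`. -/
def compressWeight (i j : Fin n) (G : Network n) (l : Fin n) : ℝ :=
  if l = i ∨ l = j then 0 else min (1 - G i l) (G j l)

def compress (i j : Fin n) (G : Network n) : Network n := G + shift i j (compressWeight i j G)

lemma compress_apply_of_ne {i j a b : Fin n} (hai : a ≠ i) (haj : a ≠ j) (hbi : b ≠ i)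
    (hbj : b ≠ j) (G : Network n) : compress i j G a b = G a b := by
  simp [compress, shift, hai, haj, hbi, hbj]

lemma compress_apply_left {i j b : Fin n} (hij : i ≠ j) (hbi : b ≠ i) (hbj : b ≠ j)
    (G : Network n) : compress i j G i b = min 1 (G i b + G j b) := by
  simp only [compress, shift, compressWeight, Matrix.add_apply, hbi, hbj, Pi.single_eq_same,
    Pi.single_eq_of_ne hij, Pi.single_eq_of_ne hbi, Pi.single_eq_of_ne hbj]
  simp only [or_self, if_false, true_or, if_true, sub_zero, one_mul, zero_mul, add_zero]
  rw [← min_add_add_left]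
  congr 1
  ring

lemma compress_apply_right {i j b : Fin n} (hij : i ≠ j) (hbi : b ≠ i) (hbj : b ≠ j)
    (G : Network n) : compress i j G j b = max 0 (G i b + G j b - 1) := by
  simp only [compress, shift, compressWeight, Matrix.add_apply, hbi, hbj, Pi.single_eq_same,
    Pi.single_eq_of_ne hij.symm, Pi.single_eq_of_ne hbi, Pi.single_eq_of_ne hbj]
  simp only [or_self, if_false, or_true, if_true, zero_sub, zero_mul, add_zero, neg_mul, one_mul]
  rcases le_total (1 - G i b) (G j b) with h | h
  · rw [min_eq_left h, max_eq_right (by linarith)]; ring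
  · rw [min_eq_right h, max_eq_left (by linarith)]; ring

lemma compress_apply_pair {i j a b : Fin n} (ha : a = i ∨ a = j) (hb : b = i ∨ b = j)
    (G : Network n) : compress i j G a b = G a b := by
  simp [compress, shift, compressWeight, ha, hb]

lemma compress_symm {i j : Fin n} (hG : ∀ a b, G a b = G b a) (a b : Fin n) :
    compress i j G a b = compress i j G b a := by
  simp only [compress, Matrix.add_apply]
  rw [hG a b, shift_symm]

lemma compress_cases {i j : Fin n} (hij : i ≠ j) (P : Fin n → Fin n → Prop)
    (hs : ∀ a b, P a b → P b a)
    (hp : ∀ a b, (a = i ∨ a = j) → (b = i ∨ b = j) → P a b)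
    (hl : ∀ b, b ≠ i → b ≠ j → P i b) (hr : ∀ b, b ≠ i → b ≠ j → P j b)
    (ho : ∀ a b, a ≠ i → a ≠ j → b ≠ i → b ≠ j → P a b) (a b : Fin n) : P a b := by
  by_cases ha : a = i ∨ a = j
  · by_cases hb : b = i ∨ b = j
    · exact hp a b ha hb
    · push Not at hb
      rcases ha with rfl | rfl
      · exact hl b hb.1 hb.2
      · exact hr b hb.1 hb.2
  · push Not at ha
    by_cases hb : b = i ∨ b = j
    · rcases hb with rfl | rfl
      · exact hs _ _ (hl a ha.1 ha.2)
      · exact hs _ _ (hr a ha.1 ha.2)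
    · push Not at hb
      exact ho a b ha.1 ha.2 hb.1 hb.2

lemma compress_mem {i j : Fin n} (hij : i ≠ j) (hG : G ∈ weightedNetworks n) :
    compress i j G ∈ weightedNetworks n := by
  have hsym := compress_symm (i := i) (j := j) fun a b => (hG a b).1
  have h01 : ∀ a b, compress i j G a b ∈ Set.Icc (0 : ℝ) 1 := by
    refine compress_cases hij _ (fun a b h => by rwa [hsym b a]) ?_ ?_ ?_ ?_
    · intro a b ha hb
      rw [compress_apply_pair ha hb]; exact (hG a b).2.1
    · intro b hbi hbj
      rw [compress_apply_left hij hbi hbj]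
      exact ⟨le_min zero_le_one (add_nonneg (hG i b).2.1.1 (hG j b).2.1.1), min_le_left _ _⟩
    · intro b hbi hbj
      rw [compress_apply_right hij hbi hbj]
      have := (hG i b).2.1.2
      have := (hG j b).2.1.2
      exact ⟨le_max_left _ _, max_le zero_le_one (by linarith)⟩
    · intro a b h1 h2 h3 h4
      rw [compress_apply_of_ne h1 h2 h3 h4]; exact (hG a b).2.1
  intro a b
  refine ⟨hsym a b, h01 a b, ?_⟩
  by_cases ha : a = i ∨ a = j
  · rw [compress_apply_pair ha ha]; exact (hG a a).2.2
  · push Not at ha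
    rw [compress_apply_of_ne ha.1 ha.2 ha.1 ha.2]; exact (hG a a).2.2

/-- The amount moved need not be monotone in `G`, but the resulting weights `min 1 (g_il + g_jl)`
and `max 0 (g_il + g_jl - 1)` are. This is what lets a whole path be compressed at once. -/
lemma compress_mono {i j : Fin n} (hij : i ≠ j) (hG : G ∈ weightedNetworks n)
    (hG' : G' ∈ weightedNetworks n) (hle : ∀ a b, G a b ≤ G' a b) (a b : Fin n) :
    compress i j G a b ≤ compress i j G' a b := by
  revert a b
  refine compress_cases hij _ (fun a b h => ?_) ?_ ?_ ?_ ?_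
  · rwa [compress_symm (fun a b => (hG a b).1) b a, compress_symm (fun a b => (hG' a b).1) b a]
  · intro a b ha hb
    rw [compress_apply_pair ha hb, compress_apply_pair ha hb]; exact hle a b
  · intro b hbi hbj
    rw [compress_apply_left hij hbi hbj, compress_apply_left hij hbi hbj]
    exact min_le_min_left _ (add_le_add (hle i b) (hle j b))
  · intro b hbi hbj
    rw [compress_apply_right hij hbi hbj, compress_apply_right hij hbi hbj]
    exact max_le_max_left _ (sub_le_sub_right (add_le_add (hle i b) (hle j b)) 1)
  · intro a b h1 h2 h3 h4
    rw [compress_apply_of_ne h1 h2 h3 h4, compress_apply_of_ne h1 h2 h3 h4]; exact hle a b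

lemma compress_feasible {i j : Fin n} (hij : i ≠ j) {s : ℕ → Network n}
    (hs : s ∈ feasiblePaths n T) : (fun t => compress i j (s t)) ∈ feasiblePaths n T := by
  refine feasible_comp ?_ (fun G hG => compress_mem hij hG)
    (fun G hG G' hG' h => compress_mono hij hG hG' h) (fun G => ?_) hs
  · have : compressWeight i j (0 : Network n) = 0 := by
      ext l; simp [compressWeight]
    ext a b
    simp [compress, this, shift]
  · simp only [compress, Matrix.add_apply, Finset.sum_add_distrib, sum_sum_shift, add_zero]

/-- Any two nodes `i`, `j` are such that, for all other nodes `l`, the link `il` has full weight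
or `jl` has no weight, or conversely. -/
def StronglyNested (G : Network n) : Prop :=
  ∀ i j l l', i ≠ j → l ≠ i → l ≠ j → l' ≠ i → l' ≠ j →
    G i l < 1 → 0 < G j l → G j l' < 1 → 0 < G i l' → False

lemma compressWeight_nonneg {i j : Fin n} (hG : G ∈ weightedNetworks n) (l : Fin n) :
    0 ≤ compressWeight i j G l := by
  unfold compressWeight
  split_ifs
  · exact le_rfl
  · exact le_min (sub_nonneg.2 (hG i l).2.1.2) (hG j l).2.1.1

lemma le_compressWeight {i j : Fin n} (hG : G ∈ weightedNetworks n) (l : Fin n) (hi : l ≠ i)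
    (hj : l ≠ j) : G j l - G i l ≤ compressWeight i j G l := by
  have h1 := (hG i l).2.1.1
  have h2 := (hG j l).2.1.2
  simp only [compressWeight, hi, hj, or_self, if_false]
  exact le_min (by linarith) (by linarith)

/-- `s` cannot be improved at time `t` without a loss in another period. -/
def Unimprovable (φ : ℝ) (T : ℕ) (s : ℕ → Network n) (t : ℕ) : Prop :=
  ∀ s' ∈ feasiblePaths n T, (∀ r ∈ Finset.Icc 1 T, kbSq φ (s r) ≤ kbSq φ (s' r)) →
    ¬ kbSq φ (s t) < kbSq φ (s' t)

/-- Compress every period towards `i`. No period loses; in period `t` the node `l` has weight to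
move, and at `l'` the amount moved strictly exceeds `g_jl' - g_il'`, so the gain there is strict. -/
lemma Unimprovable.stronglyNested
    (hsub : ∀ s ∈ feasiblePaths n T, ∀ t ∈ Finset.Icc 1 T, Subcritical φ (s t))
    {s : ℕ → Network n} (hs : s ∈ feasiblePaths n T) {t : ℕ} (ht : t ∈ Finset.Icc 1 T)
    (hu : Unimprovable φ T s t) : StronglyNested (s t) := by
  intro i j l l' hij hli hlj hli' hlj' h1 h2 h3 h4
  have hf := compress_feasible hij hs
  refine hu _ hf (fun r hr => ?_) ?_
  · have m := (hsub s hs r hr).mem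
    exact (hsub s hs r hr).kbSq_le_shift (hsub _ hf r hr) hij rfl (by simp [compressWeight])
      (by simp [compressWeight]) (compressWeight_nonneg m) (le_compressWeight m)
  · have m := (hsub s hs t ht).mem
    refine (hsub s hs t ht).kbSq_lt_shift (hsub _ hf t ht) hij rfl (by simp [compressWeight])
      (by simp [compressWeight]) (compressWeight_nonneg m) (le_compressWeight m)
      ⟨l, ?_⟩ ⟨l', hli', hlj', ?_⟩
    · simp only [compressWeight, hli, hlj, or_self, if_false]
      exact lt_min (by linarith) h2
    · simp only [compressWeight, hli', hlj', or_self, if_false]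
      exact lt_min (by linarith) (by linarith)

lemma StronglyNested.isWeightedNSG (h : StronglyNested G) (hG : G ∈ weightedNetworks n) :
    IsWeightedNSG G := by
  intro i j hij
  by_contra hc
  push Not at hc
  obtain ⟨⟨l, hli, hlj, hl⟩, ⟨l', hli', hlj', hl'⟩⟩ := hc
  exact h i j l l' hij hli hlj hli' hlj' (hl.trans_le (hG j l).2.1.2)
    ((hG i l).2.1.1.trans_lt hl) (hl'.trans_le (hG i l').2.1.2) ((hG j l').2.1.1.trans_lt hl')

/-- Two fractional links at `i` violate strong nestedness of the pair `j`, `k`, with `i` in the role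
of both witnesses. -/
lemma StronglyNested.not_two_fractional (h : StronglyNested G) (hG : G ∈ weightedNetworks n)
    {i j k : Fin n} (hjk : j ≠ k) :
    ¬ (G i j ∈ Set.Ioo (0 : ℝ) 1 ∧ G i k ∈ Set.Ioo (0 : ℝ) 1) := by
  rintro ⟨⟨h1, h2⟩, ⟨h3, h4⟩⟩
  have hij : i ≠ j := by rintro rfl; exact h1.ne' (hG i i).2.2
  have hik : i ≠ k := by rintro rfl; exact h3.ne' (hG i i).2.2
  rw [(hG i j).1] at h1 h2
  rw [(hG i k).1] at h3 h4
  exact h j k i i hjk hij hik hij hik h2 h3 h4 h1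

end SeqNet

/-! ### The gain from moving the weight of a pendant link. -/

namespace SeqNet

variable {n : ℕ} {φ : ℝ} {G G' : Network n}

/-- The adjacency matrix of the single link `uv`. -/
def link (u v : Fin n) : Network n := fun a b =>
  (Pi.single u 1 : Fin n → ℝ) a * (Pi.single v 1 : Fin n → ℝ) b +
    (Pi.single v 1 : Fin n → ℝ) a * (Pi.single u 1 : Fin n → ℝ) b

lemma link_symm (u v a b : Fin n) : link u v a b = link u v b a := by
  simp only [link]; ring

lemma sum_link_mul (u v a : Fin n) (x : Fin n → ℝ) :
    ∑ b, link u v a b * x b =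
      (Pi.single u 1 : Fin n → ℝ) a * x v + (Pi.single v 1 : Fin n → ℝ) a * x u := by
  simp [link, add_mul, Finset.sum_add_distrib, Pi.single_apply]

lemma sum_sum_link (u v : Fin n) : ∑ a, ∑ b, link u v a b = 2 := by
  have h : ∀ a, ∑ b, link u v a b =
      (Pi.single u 1 : Fin n → ℝ) a + (Pi.single v 1 : Fin n → ℝ) a := by
    intro a
    simpa using sum_link_mul u v a (fun _ => 1)
  simp only [h, Finset.sum_add_distrib]
  simp
  norm_num

/-- The gain in squared centralities from completing the link `qk` at the expense of the
pendant link `zm`. -/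
lemma pendant_gain {φ β bq bz bk bm γ yq yk ym : ℝ} (hφ : 0 < φ) (hβ0 : 0 ≤ β) (hβ1 : β ≤ 1)
    (hk : 1 ≤ bk) (hz : bz = 1 + φ * β * bm) (hq : 1 + φ * bm ≤ bq)
    (hm : (1 + φ) * (bm - bk) = φ * β * (bq + bz)) (hqk : bq ≤ bk) (hm1 : 1 ≤ bm)
    (hγ : γ = φ * β * (bq - bz + 2 * φ * bk)) (hyq : yq = φ * β * bk + φ * γ)
    (hyk : yk = (γ + (bm - bk)) / 2) (hym : ym = (γ - (bm - bk)) / 2) :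
    φ ^ 3 / (1 + φ) * β ≤ (2 * bq * yq + yq ^ 2) +
      (2 * bz * (-(φ * β * bm)) + (-(φ * β * bm)) ^ 2) +
      (2 * bk * yk + yk ^ 2) + (2 * bm * ym + ym ^ 2) := by
  obtain ⟨P, hP⟩ : ∃ P, P = φ * β := ⟨_, rfl⟩
  obtain ⟨g, hg⟩ : ∃ g, g = bq - bz + 2 * φ * bk := ⟨_, rfl⟩
  rw [← hP] at hz hm hγ hyq
  rw [← hP]
  rw [← hg] at hγ
  have hP0 : 0 ≤ P := hP ▸ mul_nonneg hφ.le hβ0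
  have hPφ : P ≤ φ := hP ▸ mul_le_of_le_one_right hφ.le hβ1
  have h1φ : 0 < 1 + φ := by linarith
  -- With `e` so normalized, `bm - bk = P e`, and the whole gain has `P = φβ` as a factor; it
  -- remains to bound the cofactor below uniformly in `β`.
  obtain ⟨e, hee⟩ : ∃ e, (1 + φ) * e = bq + bz := ⟨(bq + bz) / (1 + φ), by field_simp⟩
  have hd : bm - bk = P * e := by
    have : (1 + φ) * (bm - bk) = (1 + φ) * (P * e) := by rw [hm, ← hee]; ring
    exact mul_left_cancel₀ h1φ.ne' this
  have hbm : bm = bk + P * e := by linarith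
  have hPm : P * bm = bz - 1 := by linarith
  have hk0 : 0 < bk := by linarith
  have hz1 : 1 ≤ bz := by
    have := mul_nonneg hP0 (zero_le_one.trans hm1)
    linarith
  have hzq : bz ≤ bq := by
    have : P * bm ≤ φ * bm := mul_le_mul_of_nonneg_right hPφ (by linarith)
    linarith
  have hg0 : 2 * φ * bk ≤ g := by linarith
  have hg00 : 0 ≤ g := (by positivity : 0 ≤ 2 * φ * bk).trans hg0
  have he0 : 0 ≤ e := by
    refine nonneg_of_mul_nonneg_right (a := 1 + φ) ?_ h1φ
    rw [hee]; linarith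
  have hexp : (2 * bq * yq + yq ^ 2) + (2 * bz * (-(P * bm)) + (-(P * bm)) ^ 2) +
      (2 * bk * yk + yk ^ 2) + (2 * bm * ym + ym ^ 2) =
      P * (2 * bq * bk - bm * (1 + bz) + 2 * bq * (φ * g) + P * (bk + φ * g) ^ 2
        + g * (2 * bk + P * e) + P * g ^ 2 / 2 - P * e ^ 2 / 2) := by
    have h2 : 2 * bz * (-(P * bm)) + (-(P * bm)) ^ 2 = P * (-(bm * (1 + bz))) := by
      have : P * (-(bm * (1 + bz))) = -(P * bm) * (1 + bz) := by ring
      rw [this, hPm]; ring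
    rw [h2, hyq, hyk, hym, hd, hγ, hbm]
    ring
  rw [hexp]
  have hek : (1 + φ) * e ≤ 2 * bk := by linarith
  have hek' : e ≤ 2 * bk := by
    have := mul_nonneg hφ.le he0
    linarith
  have hbkm : bk ≤ bm := by
    have := mul_nonneg hP0 he0
    linarith
  have i1 : bk * (φ * bk) ≤ bk * (bq - 1) := by
    refine mul_le_mul_of_nonneg_left ?_ hk0.le
    have := mul_le_mul_of_nonneg_left hbkm hφ.le
    linarith
  have i2 : e * (1 + bz) ≤ e * (2 * bk) := mul_le_mul_of_nonneg_left (by linarith) he0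
  have i3 : 0 ≤ bk * (bq - bz) := mul_nonneg (by linarith) (by linarith)
  have i4 : 2 * φ * bk * (2 * bk) ≤ g * (2 * bk) :=
    mul_le_mul_of_nonneg_right hg0 (by linarith)
  have i5 : bk ^ 2 ≤ (bk + φ * g) ^ 2 :=
    pow_le_pow_left₀ (by linarith) (by linarith [mul_nonneg hφ.le hg00]) 2
  have i6 : 0 ≤ bq * (φ * g) := mul_nonneg (by linarith) (mul_nonneg hφ.le hg00)
  have i7 : 0 ≤ g * (P * e) := mul_nonneg hg00 (mul_nonneg hP0 he0)
  have i8 : e * e ≤ e * (2 * bk) := mul_le_mul_of_nonneg_left hek' he0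
  have j2 := mul_le_mul_of_nonneg_left i2 hP0
  have j5 := mul_le_mul_of_nonneg_left i5 hP0
  have j8 := mul_le_mul_of_nonneg_left i8 hP0
  have j9 : 0 ≤ P * g ^ 2 := mul_nonneg hP0 (sq_nonneg g)
  -- The `5φ bk²` collects one part from `bk (bq - 1)` and four from `2 g bk`. The one negative term
  -- left is absorbed by `(1 + φ) e ≤ 2 bk` and `P ≤ φ`.
  have k1 : 5 * φ * bk ^ 2 + P * bk ^ 2 - P * (3 * e * bk) ≤
      2 * bq * bk - bm * (1 + bz) + 2 * bq * (φ * g) + P * (bk + φ * g) ^ 2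
        + g * (2 * bk + P * e) + P * g ^ 2 / 2 - P * e ^ 2 / 2 := by
    have : bm * (1 + bz) = bk * (1 + bz) + P * (e * (1 + bz)) := by rw [hbm]; ring
    rw [this]
    linarith
  have k2 : (1 + φ) * (P * (3 * e * bk)) ≤ P * 6 * bk ^ 2 := by
    have := mul_le_mul_of_nonneg_left hek (mul_nonneg hP0 (by linarith : (0:ℝ) ≤ 3 * bk))
    linarith
  have k3 : φ ^ 2 * bk ^ 2 ≤ (1 + φ) * (5 * φ * bk ^ 2 + P * bk ^ 2 - P * (3 * e * bk)) := by
    have : 0 ≤ (5 * (φ - P) + 4 * φ ^ 2 + P * φ) * bk ^ 2 := by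
      have := sub_nonneg.2 hPφ
      positivity
    linarith
  have k4 : φ ^ 2 ≤ φ ^ 2 * bk ^ 2 :=
    le_mul_of_one_le_right (sq_nonneg φ) (one_le_pow₀ hk)
  have k5 : φ ^ 2 / (1 + φ) ≤ 5 * φ * bk ^ 2 + P * bk ^ 2 - P * (3 * e * bk) := by
    rw [div_le_iff₀ h1φ]; linarith
  calc φ ^ 3 / (1 + φ) * β = P * (φ ^ 2 / (1 + φ)) := by rw [hP]; ring
    _ ≤ _ := mul_le_mul_of_nonneg_left (k5.trans k1) hP0

/-- The network `G` consists of a quasi-complete graph whose last link `qk` only has weight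
`1 - β`, and of a link of weight `β` joining the node `z` of degree one to `m`. -/
structure HasPendant (G : Network n) (β : ℝ) (q k z m : Fin n) : Prop where
  qk : q ≠ k
  qz : q ≠ z
  qm : q ≠ m
  kz : k ≠ z
  km : k ≠ m
  zm : z ≠ m
  pos : 0 < β
  le_one : β ≤ 1
  weight_zm : G z m = β
  weight_qk : G q k = 1 - β
  weight_qm : G q m = 1
  weight_km : G k m = 1
  weight_z : ∀ l, l ≠ m → G z l = 0
  twin : ∀ l, l ≠ q → l ≠ k → l ≠ z → l ≠ m → G k l = G m l
  dom : ∀ l, l ≠ k → l ≠ q → G q l ≤ G k l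

/-- These four relations are all that the gain estimate uses about `G`. Row `z` has a single entry;
row `q` contains a full link to `m`; rows `k` and `m` differ only at `q`, `k`, `z`, `m`; and `k`
dominates `q`. -/
lemma HasPendant.kb_relations {β : ℝ} {q k z m : Fin n} (hp : HasPendant G β q k z m)
    (h : Subcritical φ G) :
    kb φ G z = 1 + φ * β * kb φ G m ∧ 1 + φ * kb φ G m ≤ kb φ G q ∧
      (1 + φ) * (kb φ G m - kb φ G k) = φ * β * (kb φ G q + kb φ G z) ∧
      kb φ G q ≤ kb φ G k := by
  obtain ⟨qk, qz, qm, kz, km, zm, hβ0, hβ1, wzm, wqk, wqm, wkm, wz, tw, dom⟩ := hp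
  have hφ := h.pos
  have hb1 := h.one_le_kb
  have hbe := h.kb_eq
  have wkz : G k z = 0 := by rw [h.symm]; exact wz k km
  generalize kb φ G = b at *
  have F1 : b z = 1 + φ * β * b m := by
    rw [hbe z, Finset.sum_eq_single m (fun l _ hl => by rw [wz l hl, zero_mul]) (by simp), wzm]
    ring
  have F2 : 1 + φ * b m ≤ b q := by
    have := Finset.single_le_sum (f := fun l => G q l * b l)
      (fun l _ => mul_nonneg (h.nonneg q l) (zero_le_one.trans (hb1 l))) (Finset.mem_univ m)
    simp only [wqm, one_mul] at this
    rw [hbe q]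
    have := mul_le_mul_of_nonneg_left this hφ.le
    linarith
  have F3 : (1 + φ) * (b m - b k) = φ * β * (b q + b z) := by
    have e : ∀ l, (G m l - G k l) * b l = (Pi.single k (b k) : Fin n → ℝ) l
        - (Pi.single m (b m) : Fin n → ℝ) l + (Pi.single q (β * b q) : Fin n → ℝ) l
        + (Pi.single z (β * b z) : Fin n → ℝ) l := by
      intro l
      by_cases l1 : l = q
      · subst l1; simp [qk, qz, qm, h.symm m l, h.symm k l, wqm, wqk]
      by_cases l2 : l = k
      · subst l2; simp [qk.symm, kz, km, h.diag, h.symm m l, wkm]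
      by_cases l3 : l = z
      · subst l3; simp [qz.symm, kz.symm, zm, wkz, h.symm m l, wzm]
      by_cases l4 : l = m
      · subst l4; simp [qm.symm, km.symm, zm.symm, h.diag, wkm]
      · simp [l1, l2, l3, l4, tw l l1 l2 l3 l4]
    have e2 : ∑ l, (G m l - G k l) * b l = b k - b m + β * b q + β * b z := by
      simp only [e, Finset.sum_add_distrib, Finset.sum_sub_distrib]; simp
    simp only [sub_mul, Finset.sum_sub_distrib] at e2
    have := hbe m
    have := hbe k
    have := congrArg (φ * ·) e2
    linarith
  have F4 : b q ≤ b k := by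
    have e : ∀ l, (Pi.single q ((1 - β) * b q) : Fin n → ℝ) l
        - (Pi.single k ((1 - β) * b k) : Fin n → ℝ) l ≤ (G k l - G q l) * b l := by
      intro l
      by_cases l1 : l = q
      · subst l1; simp [qk, h.symm k l, wqk, h.diag]
      by_cases l2 : l = k
      · subst l2; simp [qk.symm, h.diag, wqk]; linarith
      · simp only [Pi.single_eq_of_ne l1, Pi.single_eq_of_ne l2, sub_zero]
        exact mul_nonneg (sub_nonneg.2 (dom l l2 l1)) (zero_le_one.trans (hb1 l))
    have e2 := Finset.sum_le_sum fun l (_ : l ∈ Finset.univ) => e l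
    simp only [sub_mul, Finset.sum_sub_distrib, Finset.sum_pi_single', Finset.mem_univ,
      if_true, one_mul] at e2
    have h1 := hbe q
    have h2 := hbe k
    have h3 := mul_le_mul_of_nonneg_left e2 hφ.le
    have h4 : 0 ≤ (1 + φ * (1 - β)) * (b k - b q) := by linarith
    have h5 : 0 < 1 + φ * (1 - β) := by nlinarith
    have := nonneg_of_mul_nonneg_right h4 h5
    linarith
  exact ⟨F1, F2, F3, F4⟩

/-- The sub-solution is `b + y` with `y` supported on `q`, `z`, `k`, `m`. The value at `z` becomes
1, as `z` ends up isolated; the values at `k` and `m` become equal, as these nodes become twins;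
`yq` makes row `q` an equality. The total increase `γ` of `k` and `m` is chosen so that their rows
hold with slack. -/
lemma HasPendant.kbSq_add_le {β : ℝ} {q k z m : Fin n} (hp : HasPendant G β q k z m)
    (h : Subcritical φ G) (h' : Subcritical φ G')
    (hG : G' = G + β • (link q k - link z m)) :
    kbSq φ G + φ ^ 3 / (1 + φ) * β ≤ kbSq φ G' := by
  obtain ⟨F1, F2, F3, F4⟩ := hp.kb_relations h
  obtain ⟨qk, qz, qm, kz, km, zm, hβ0, hβ1, wzm, wqk, wqm, wkm, wz, tw, dom⟩ := hp
  have hφ := h.pos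
  have hb1 := h.one_le_kb
  have hbe := h.kb_eq
  have wqz : G q z = 0 := by rw [h.symm]; exact wz q qm
  have wkz : G k z = 0 := by rw [h.symm]; exact wz k km
  have hdef : kbSq φ G = ∑ l, kb φ G l ^ 2 := rfl
  generalize kb φ G = b at *
  -- the sub-solution
  obtain ⟨γ, hγ⟩ : ∃ γ, γ = φ * β * (b q - b z + 2 * φ * b k) := ⟨_, rfl⟩
  obtain ⟨yq, hyq⟩ : ∃ yq, yq = φ * β * b k + φ * γ := ⟨_, rfl⟩
  obtain ⟨yk, hyk⟩ : ∃ yk, yk = (γ + (b m - b k)) / 2 := ⟨_, rfl⟩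
  obtain ⟨ym, hym⟩ : ∃ ym, ym = (γ - (b m - b k)) / 2 := ⟨_, rfl⟩
  obtain ⟨yz, hyz⟩ : ∃ yz, yz = -(φ * β * b m) := ⟨_, rfl⟩
  have hgain := pendant_gain hφ hβ0.le hβ1 (hb1 k) F1 F2 F3 F4 (hb1 m) hγ hyq hyk hym
  rw [← hyz] at hgain
  have hP0 : 0 < φ * β := mul_pos hφ hβ0
  have hzq : b z ≤ b q := by
    have : φ * β * b m ≤ φ * b m := mul_le_mul_of_nonneg_right
      (mul_le_of_le_one_right hφ.le hβ1) (zero_le_one.trans (hb1 m))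
    linarith
  have hγ0 : 0 ≤ γ := by
    have := mul_nonneg hφ.le (zero_le_one.trans (hb1 k))
    rw [hγ]
    exact mul_nonneg hP0.le (by linarith)
  have hkm : yk + ym = γ := by rw [hyk, hym]; ring
  have hφγ : 0 ≤ φ * γ := mul_nonneg hφ.le hγ0
  have hφφγ : 0 ≤ φ * (φ * γ) := mul_nonneg hφ.le hφγ
  have hyq0 : 0 ≤ yq := by
    rw [hyq]
    exact add_nonneg (mul_nonneg hP0.le (zero_le_one.trans (hb1 k))) hφγ
  let y : Fin n → ℝ := fun l => (Pi.single q yq : Fin n → ℝ) l + (Pi.single z yz : Fin n → ℝ) l +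
    (Pi.single k yk : Fin n → ℝ) l + (Pi.single m ym : Fin n → ℝ) l
  have yq_eq : y q = yq := by simp [y, qk, qz, qm]
  have yz_eq : y z = yz := by simp [y, qz.symm, kz.symm, zm]
  have yk_eq : y k = yk := by simp [y, qk.symm, kz, km]
  have ym_eq : y m = ym := by simp [y, qm.symm, zm.symm, km.symm]
  have y_eq : ∀ l, l ≠ q → l ≠ z → l ≠ k → l ≠ m → y l = 0 := by
    intro l h1 h2 h3 h4; simp [y, h1, h2, h3, h4]
  have hG'b : ∀ a c, G' a c = G a c + β * (link q k a c - link z m a c) := by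
    intro a c; simp [hG]
  have hrow : ∀ a, ∑ c, G' a c * (b c + y c) = (∑ c, G a c * b c)
      + β * ((Pi.single q 1 : Fin n → ℝ) a * b k + (Pi.single k 1 : Fin n → ℝ) a * b q
        - (Pi.single z 1 : Fin n → ℝ) a * b m - (Pi.single m 1 : Fin n → ℝ) a * b z)
      + (G' a q * yq + G' a z * yz + G' a k * yk + G' a m * ym) := by
    intro a
    have e1 : ∑ c, G' a c * y c = G' a q * yq + G' a z * yz + G' a k * yk + G' a m * ym := by
      simp only [y, mul_add, Finset.sum_add_distrib]
      simp [Pi.single_apply]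
    have e2 : ∑ c, G' a c * b c = (∑ c, G a c * b c)
        + β * ((∑ c, link q k a c * b c) - ∑ c, link z m a c * b c) := by
      rw [← Finset.sum_sub_distrib, Finset.mul_sum, ← Finset.sum_add_distrib]
      exact Finset.sum_congr rfl fun c _ => by rw [hG'b]; ring
    simp only [mul_add, Finset.sum_add_distrib] at e1 ⊢
    rw [e1, e2, sum_link_mul, sum_link_mul]
    ring
  have gqz : G' q z = 0 := by rw [hG'b]; simp [link, qk, qz, qm, qz.symm, kz.symm, wqz]
  have gqk : G' q k = 1 := by rw [hG'b]; simp [link, qk, qz, qm, qk.symm, kz, km, wqk]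
  have gqm : G' q m = 1 := by rw [hG'b]; simp [link, qz, qm, qm.symm, km.symm, wqm]
  have gzk : G' z k = 0 := by rw [hG'b]; simp [link, qz.symm, kz.symm, kz, km, zm, h.symm z k, wkz]
  have gzm : G' z m = 0 := by rw [hG'b]; simp [link, qz.symm, kz.symm, zm, zm.symm, wzm]
  have gkm : G' k m = 1 := by
    rw [hG'b]; simp [link, qk.symm, km, kz, km.symm, qm.symm, wkm]
  have hle : ∀ l, b l + y l ≤ kb φ G' l := by
    apply h'.le_kb
    intro l
    rw [hrow l]
    have hl := hbe l
    by_cases l1 : l = q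
    · subst l1
      rw [yq_eq]
      simp only [Pi.single_eq_same, Pi.single_eq_of_ne qk, Pi.single_eq_of_ne qz,
        Pi.single_eq_of_ne qm, h'.diag, gqz, gqk, gqm]
      have := congrArg (φ * ·) hkm
      linarith
    by_cases l2 : l = k
    · subst l2
      rw [yk_eq, hyk]
      simp only [Pi.single_eq_same, Pi.single_eq_of_ne qk.symm, Pi.single_eq_of_ne kz,
        Pi.single_eq_of_ne km, h'.diag, h'.symm l q, h'.symm l z, gzk, gqk, gkm]
      rw [hyq, hym]
      linarith
    by_cases l3 : l = z
    · subst l3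
      rw [yz_eq]
      simp only [Pi.single_eq_same, Pi.single_eq_of_ne qz.symm, Pi.single_eq_of_ne kz.symm,
        Pi.single_eq_of_ne zm, h'.diag, h'.symm l q, gzk, gqz, gzm]
      linarith
    by_cases l4 : l = m
    · subst l4
      rw [ym_eq, hym]
      simp only [Pi.single_eq_same, Pi.single_eq_of_ne qm.symm, Pi.single_eq_of_ne zm.symm,
        Pi.single_eq_of_ne km.symm, h'.diag, h'.symm l q, h'.symm l z, h'.symm l k, gqm, gzm, gkm]
      rw [hyq, hyk]
      linarith
    · rw [y_eq l l1 l3 l2 l4]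
      simp only [Pi.single_eq_of_ne l1, Pi.single_eq_of_ne l2, Pi.single_eq_of_ne l3,
        Pi.single_eq_of_ne l4]
      -- In the remaining rows `yz` has no effect and `yk`, `ym` have the same coefficient, so only
      -- their sum `γ ≥ 0` matters, although `ym` itself may be negative.
      have glz : G' l z = 0 := by
        rw [hG'b]; simp [link, l1, l2, l3, l4, h.symm l z, wz l l4]
      have glkm : G' l k = G' l m := by
        rw [hG'b, hG'b]; simp [link, l1, l2, l3, l4, h.symm l k, h.symm l m, tw l l1 l2 l3 l4]
      rw [glz, glkm]
      have h1 : 0 ≤ G' l q * yq := mul_nonneg (h'.nonneg _ _) hyq0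
      have h2 : 0 ≤ G' l m * (yk + ym) := mul_nonneg (h'.nonneg _ _) (by
        rw [hkm]; exact hγ0)
      have := mul_nonneg hφ.le (add_nonneg h1 h2)
      linarith
  have hx0 : ∀ l, 0 ≤ b l + y l := by
    have d0 : 0 ≤ b m - b k := by
      have : 0 ≤ (1 + φ) * (b m - b k) := by
        rw [F3]; exact mul_nonneg hP0.le (by linarith [hb1 q, hb1 z])
      exact nonneg_of_mul_nonneg_right this (by linarith)
    intro l
    by_cases l1 : l = q
    · rw [l1, yq_eq]; linarith [hb1 q]
    by_cases l2 : l = k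
    · rw [l2, yk_eq, hyk]; linarith [hb1 k]
    by_cases l3 : l = z
    · rw [l3, yz_eq, hyz]; linarith
    by_cases l4 : l = m
    · rw [l4, ym_eq, hym]; linarith [hb1 k]
    · rw [y_eq l l1 l3 l2 l4]; linarith [hb1 l]
  have hsum : ∑ l, (b l + y l) ^ 2 ≤ kbSq φ G' :=
    Finset.sum_le_sum fun l _ => pow_le_pow_left₀ (hx0 l) (hle l) 2
  have hexp : ∑ l, (b l + y l) ^ 2 = (∑ l, b l ^ 2) + ((2 * b q * yq + yq ^ 2) +
      (2 * b z * yz + yz ^ 2) + (2 * b k * yk + yk ^ 2) + (2 * b m * ym + ym ^ 2)) := by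
    have e : ∀ l, (b l + y l) ^ 2 = b l ^ 2 +
        ((Pi.single q (2 * b q * yq + yq ^ 2) : Fin n → ℝ) l +
        (Pi.single z (2 * b z * yz + yz ^ 2) : Fin n → ℝ) l +
        (Pi.single k (2 * b k * yk + yk ^ 2) : Fin n → ℝ) l +
        (Pi.single m (2 * b m * ym + ym ^ 2) : Fin n → ℝ) l) := by
      intro l
      by_cases l1 : l = q
      · rw [l1, yq_eq]; simp [qk, qz, qm]; ring
      by_cases l2 : l = k
      · rw [l2, yk_eq]; simp [qk.symm, kz, km]; ring
      by_cases l3 : l = z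
      · rw [l3, yz_eq]; simp [qz.symm, kz.symm, zm]; ring
      by_cases l4 : l = m
      · rw [l4, ym_eq]; simp [qm.symm, zm.symm, km.symm]; ring
      · rw [y_eq l l1 l3 l2 l4]; simp [l1, l2, l3, l4]
    simp only [e, Finset.sum_add_distrib]
    simp
  rw [hdef]
  linarith

end SeqNet

/-! ### Adding one unit of weight to a quasi-complete graph. -/

namespace SeqNet

variable {n : ℕ} {φ : ℝ} {G G' G₀ G₁ W : Network n}

lemma succ_choose_two (c : ℕ) : (c + 1).choose 2 = c + c.choose 2 := by
  rw [Nat.choose_succ_succ' c 1, Nat.choose_one_right]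

lemma link_apply {u v : Fin n} (huv : u ≠ v) (a b : Fin n) :
    link u v a b = if (a = u ∧ b = v) ∨ (a = v ∧ b = u) then 1 else 0 := by
  by_cases h1 : a = u <;> by_cases h2 : b = v <;> by_cases h3 : a = v <;> by_cases h4 : b = u <;>
    simp_all [link]

/-- A matrix that vanishes outside one link is a multiple of that link. -/
lemma eq_smul_link (hW : ∀ a b, W a b = W b a) {u v : Fin n} (huv : u ≠ v)
    (h : ∀ a b, W a b ≠ 0 → (a = u ∧ b = v) ∨ (a = v ∧ b = u)) (a b : Fin n) :
    W a b = W u v * link u v a b := by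
  rw [link_apply huv]
  split_ifs with hab
  · rcases hab with ⟨rfl, rfl⟩ | ⟨rfl, rfl⟩
    · simp
    · rw [hW]; simp
  · by_contra hc
    exact hab (h a b (by simpa using hc))

lemma eq_smul_link_add (hW : ∀ a b, W a b = W b a) {u v x y : Fin n} (huv : u ≠ v) (hxy : x ≠ y)
    (hux : u ≠ x) (huy : u ≠ y)
    (h : ∀ a b, W a b ≠ 0 → ((a = u ∧ b = v) ∨ (a = v ∧ b = u)) ∨
      ((a = x ∧ b = y) ∨ (a = y ∧ b = x))) (a b : Fin n) :
    W a b = W u v * link u v a b + W x y * link x y a b := by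
  rw [link_apply huv, link_apply hxy]
  by_cases h1 : (a = u ∧ b = v) ∨ (a = v ∧ b = u)
  · have h2 : ¬ ((a = x ∧ b = y) ∨ (a = y ∧ b = x)) := by
      rintro (⟨rfl, rfl⟩ | ⟨rfl, rfl⟩) <;> rcases h1 with ⟨rfl, rfl⟩ | ⟨rfl, rfl⟩ <;> simp_all
    rw [if_pos h1, if_neg h2]
    rcases h1 with ⟨rfl, rfl⟩ | ⟨rfl, rfl⟩
    · simp
    · rw [hW]; simp
  · rw [if_neg h1]
    by_cases h2 : (a = x ∧ b = y) ∨ (a = y ∧ b = x)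
    · rw [if_pos h2]
      rcases h2 with ⟨rfl, rfl⟩ | ⟨rfl, rfl⟩
      · simp
      · rw [hW]; simp
    · rw [if_neg h2]
      by_contra hc
      rcases h a b (by simpa using hc) with h | h
      exacts [h1 h, h2 h]

lemma sum_eq_of_link {c : ℝ} {u v : Fin n} (h : ∀ a b, W a b = c * link u v a b) :
    ∑ a, ∑ b, W a b = 2 * c := by
  simp only [h, ← Finset.mul_sum, sum_sum_link]; ring

/-- The weights of two distinct links add up to at most half of the total weight. -/
lemma add_le_of_sum (hW : ∀ a b, W a b = W b a) (h0 : ∀ a b, 0 ≤ W a b)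
    (hs : ∑ a, ∑ b, W a b = 2) {u v y : Fin n} (huv : u ≠ v) (huy : u ≠ y) (hvy : v ≠ y) :
    W u v + W u y ≤ 1 := by
  have hle : ∀ a b, W u v * link u v a b + W u y * link u y a b ≤ W a b := by
    intro a b
    rw [link_apply huv, link_apply huy]
    by_cases h1 : (a = u ∧ b = v) ∨ (a = v ∧ b = u)
    · have h2 : ¬ ((a = u ∧ b = y) ∨ (a = y ∧ b = u)) := by
          grind
      rw [if_pos h1, if_neg h2]
      rcases h1 with ⟨rfl, rfl⟩ | ⟨rfl, rfl⟩
      · simp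
      · rw [hW a b]; simp
    · rw [if_neg h1]
      split_ifs with h2
      · rcases h2 with ⟨rfl, rfl⟩ | ⟨rfl, rfl⟩
        · simp
        · rw [hW a b]; simp
      · simpa using h0 a b
  have := Finset.sum_le_sum fun a (_ : a ∈ Finset.univ) =>
    Finset.sum_le_sum fun b (_ : b ∈ Finset.univ) => hle a b
  simp only [Finset.sum_add_distrib, ← Finset.mul_sum, sum_sum_link] at this
  linarith

/-- A unit of weight is added to the unweighted network `G₀`, and the resulting network `G₁` is
strongly nested. -/
structure NestedStep (G₀ G₁ : Network n) : Prop where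
  mem₀ : G₀ ∈ weightedNetworks n
  mem₁ : G₁ ∈ weightedNetworks n
  zero_or_one : ∀ i j, G₀ i j = 0 ∨ G₀ i j = 1
  le : ∀ i j, G₀ i j ≤ G₁ i j
  sum : ∑ i, ∑ j, G₁ i j = (∑ i, ∑ j, G₀ i j) + 2
  nested : StronglyNested G₁

namespace NestedStep

lemma symm (h : NestedStep G₀ G₁) (a b : Fin n) : G₁ a b - G₀ a b = G₁ b a - G₀ b a := by
  rw [(h.mem₁ a b).1, (h.mem₀ a b).1]

lemma sum_sub (h : NestedStep G₀ G₁) : ∑ a, ∑ b, (G₁ a b - G₀ a b) = 2 := by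
  have := h.sum
  simp only [Finset.sum_sub_distrib]
  linarith

lemma eq_zero (h : NestedStep G₀ G₁) {a b : Fin n} (hab : G₀ a b < G₁ a b) : G₀ a b = 0 :=
  (h.zero_or_one a b).resolve_right fun h1 => by
    rw [h1] at hab
    exact absurd hab (not_lt.2 (h.mem₁ a b).2.1.2)

lemma ne (h : NestedStep G₀ G₁) {a b : Fin n} (hab : G₀ a b < G₁ a b) : a ≠ b := by
  rintro rfl
  rw [(h.mem₀ a a).2.2, (h.mem₁ a a).2.2] at hab
  exact lt_irrefl _ hab

lemma lt_symm (h : NestedStep G₀ G₁) {a b : Fin n} (hab : G₀ a b < G₁ a b) : G₀ b a < G₁ b a := by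
  rwa [(h.mem₀ b a).1, (h.mem₁ b a).1]

lemma pos (h : NestedStep G₀ G₁) {a b : Fin n} (hab : G₀ a b < G₁ a b) : 0 < G₁ a b := by
  rwa [h.eq_zero hab] at hab

/-- The links that receive weight form a matching. -/
lemma matching (h : NestedStep G₀ G₁) {a b c : Fin n} (hab : G₀ a b < G₁ a b)
    (hac : G₀ a c < G₁ a c) : b = c := by
  by_contra hbc
  -- Two links at `a` that receive weight had none before and share at most one unit, so both would
  -- be fractional.
  have h2 := add_le_of_sum (W := fun a b => G₁ a b - G₀ a b) h.symm
    (fun a b => sub_nonneg.2 (h.le a b)) h.sum_sub (h.ne hab) (h.ne hac) hbc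
  rw [h.eq_zero hab, h.eq_zero hac] at h2
  have hb := h.pos hab
  have hc := h.pos hac
  exact h.nested.not_two_fractional h.mem₁ (i := a) hbc
    ⟨⟨hb, by linarith⟩, ⟨hc, by linarith⟩⟩

lemma eq_of_ne_partner (h : NestedStep G₀ G₁) {a b c : Fin n} (hab : G₀ a b < G₁ a b)
    (hbc : b ≠ c) :
    G₁ a c = G₀ a c :=
  le_antisymm (not_lt.1 fun hac => hbc (h.matching hab hac)) (h.le a c)

lemma exists_lt (h : NestedStep G₀ G₁) : ∃ a b, G₀ a b < G₁ a b := by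
  by_contra hc
  push Not at hc
  have := h.sum
  have h2 := Finset.sum_le_sum fun a (_ : a ∈ Finset.univ) =>
    Finset.sum_le_sum fun b (_ : b ∈ Finset.univ) => hc a b
  linarith

/-- If only one link receives weight, then it receives a full unit. -/
lemma eq_add_link (h : NestedStep G₀ G₁) {u v : Fin n} (huv : u ≠ v)
    (hu : ∀ a b, G₀ a b < G₁ a b → (a = u ∧ b = v) ∨ (a = v ∧ b = u)) (a b : Fin n) :
    G₁ a b = G₀ a b + link u v a b := by
  have e := eq_smul_link (W := fun a b => G₁ a b - G₀ a b) h.symm huv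
    (fun a b hab => hu a b (lt_of_le_of_ne (h.le a b) fun h0 => hab (by simp [h0])))
  have e2 := sum_eq_of_link e
  rw [h.sum_sub] at e2
  have := e a b
  rw [show G₁ u v - G₀ u v = 1 by linarith] at this
  linarith

/-- If two links receive weight, then together they receive a full unit. -/
lemma eq_add_link_add (h : NestedStep G₀ G₁) {u v x y : Fin n} (huv : u ≠ v) (hxy : x ≠ y)
    (hux : u ≠ x) (huy : u ≠ y)
    (hu : ∀ a b, G₀ a b < G₁ a b → ((a = u ∧ b = v) ∨ (a = v ∧ b = u)) ∨
      ((a = x ∧ b = y) ∨ (a = y ∧ b = x))) :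
    G₁ u v - G₀ u v = 1 - (G₁ x y - G₀ x y) ∧ ∀ a b, G₁ a b = G₀ a b +
      (1 - (G₁ x y - G₀ x y)) * link u v a b + (G₁ x y - G₀ x y) * link x y a b := by
  have e := eq_smul_link_add (W := fun a b => G₁ a b - G₀ a b) h.symm huv hxy hux huy
    (fun a b hab => hu a b (lt_of_le_of_ne (h.le a b) fun h0 => hab (by simp [h0])))
  have e2 := h.sum_sub
  rw [Finset.sum_congr rfl fun a _ => Finset.sum_congr rfl fun b _ => e a b] at e2
  simp only [Finset.sum_add_distrib, ← Finset.mul_sum, sum_sum_link] at e2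
  have e3 : G₁ u v - G₀ u v = 1 - (G₁ x y - G₀ x y) := by linarith
  refine ⟨e3, fun a b => ?_⟩
  have := e a b
  rw [e3] at this
  linarith

/-- From the empty network, a single link is formed. -/
lemma isQuasiComplete_of_zero (h : NestedStep G₀ G₁) (h0 : ∀ a b, G₀ a b = 0) :
    IsQuasiComplete 1 G₁ := by
  classical
  obtain ⟨a, b, hab⟩ := h.exists_lt
  have hne := h.ne hab
  have e := h.eq_add_link hne (fun c d hcd => by
    by_contra hc
    have hca : c ≠ a := by
      rintro rfl; exact hc (Or.inl ⟨rfl, h.matching hcd hab⟩)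
    have hcb : c ≠ b := by
      rintro rfl; exact hc (Or.inr ⟨rfl, h.matching hcd (h.lt_symm hab)⟩)
    have hdb : d ≠ b := by
      rintro rfl; exact hca (h.matching (h.lt_symm hcd) (h.lt_symm hab))
    have hda : d ≠ a := by
      rintro rfl; exact hcb (h.matching (h.lt_symm hcd) hab)
    -- By the matching property a second weighted link `cd` is disjoint from `ab`; then neither of
    -- `a` and `c` dominates the other.
    refine h.nested a c d b hca.symm hda (h.ne hcd).symm hne.symm hcb.symm ?_ (h.pos hcd) ?_
      (h.pos hab)
    · rw [h.eq_of_ne_partner hab hdb.symm, h0]; exact one_pos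
    · rw [h.eq_of_ne_partner hcd hdb, h0]; exact one_pos)
  refine ⟨{a, b}, ∅, a, by simp, by simp, ?_, ?_, ?_, ?_⟩
  · rw [Finset.card_pair hne]; decide
  · rw [Finset.card_pair hne]; decide
  · rw [Finset.card_pair hne, Finset.card_empty]; rfl
  · intro i j
    rw [e, h0, link_apply hne, zero_add]
    congr 1
    simp only [Finset.mem_insert, Finset.mem_singleton, Finset.notMem_empty, eq_iff_iff]
    grind

end NestedStep

section QuasiComplete

open Classical in
/-- The quasi-complete graph with clique `K` and further node `q` linked to `R ⊆ K`. -/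
def quasiComplete (K R : Finset (Fin n)) (q : Fin n) : Network n := fun i j =>
  if i ≠ j ∧ ((i ∈ K ∧ j ∈ K) ∨ (i = q ∧ j ∈ R) ∨ (i ∈ R ∧ j = q)) then 1 else 0

variable {K R : Finset (Fin n)} {q : Fin n}

lemma quasiComplete_zero_or_one (i j : Fin n) :
    quasiComplete K R q i j = 0 ∨ quasiComplete K R q i j = 1 := by
  unfold quasiComplete
  split_ifs <;> simp

lemma quasiComplete_clique {i j : Fin n} (hij : i ≠ j) (hi : i ∈ K) (hj : j ∈ K) :
    quasiComplete K R q i j = 1 := by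
  simp [quasiComplete, hij, hi, hj]

lemma quasiComplete_outside {i j : Fin n} (hRK : R ⊆ K) (hi : i ∉ K) (h : i = q → j ∉ R) :
    quasiComplete K R q i j = 0 := by
  have : i ∉ R := fun h => hi (hRK h)
  simp only [quasiComplete, hi, this, false_and, false_or, or_false]
  rw [if_neg]
  rintro ⟨-, h1, h2⟩
  exact h h1 h2

lemma quasiComplete_last {j : Fin n} (hqj : q ≠ j) (hj : j ∈ R) :
    quasiComplete K R q q j = 1 := by
  simp [quasiComplete, hqj, hj]

namespace NestedStep

/-- A link that receives weight has an end in the clique. -/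
lemma mem_or_mem
    (h : NestedStep (quasiComplete K R q) G₁) (hRK : R ⊆ K) (hcard : R.card < K.card)
    (hK : 2 ≤ K.card) {a b : Fin n} (hab : quasiComplete K R q a b < G₁ a b) : a ∈ K ∨ b ∈ K := by
  by_contra hc
  push Not at hc
  obtain ⟨ha, hb⟩ := hc
  have key : ∀ a b, quasiComplete K R q a b < G₁ a b → a ∉ K → b ∉ K → (a = q → R = ∅) →
      False := by
    intro a b hab ha hb haq
    -- Strong nestedness fails for `x` and `a`: `x` has the clique link `xy` and `a` has `ab`.
    -- Taking `x` outside `R` keeps `xb` unlinked before the step even if `b = q`.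
    obtain ⟨x, hxK, hxR⟩ := Finset.exists_mem_notMem_of_card_lt_card hcard
    obtain ⟨y, hyK, hyx⟩ := Finset.exists_mem_ne (by omega : 1 < K.card) x
    have hbx : b ≠ x := fun e => hb (e ▸ hxK)
    have hax : a ≠ x := fun e => ha (e ▸ hxK)
    have hay : a ≠ y := fun e => ha (e ▸ hyK)
    have hby : b ≠ y := fun e => hb (e ▸ hyK)
    refine h.nested x a b y hax.symm hbx (h.ne hab).symm hyx hay.symm ?_ (h.pos hab) ?_ ?_
    · rw [(h.mem₁ x b).1, h.eq_of_ne_partner (h.lt_symm hab) hax,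
        quasiComplete_outside hRK hb fun _ => hxR]
      exact one_pos
    · rw [h.eq_of_ne_partner hab hby, quasiComplete_outside hRK ha fun e => by simp [haq e]]
      exact one_pos
    · refine one_pos.trans_le ?_
      rw [← quasiComplete_clique (K := K) (R := R) (q := q) hyx.symm hxK hyK]
      exact h.le x y
  by_cases haq : a = q → R = ∅
  · exact key a b hab ha hb haq
  · push Not at haq
    exact key b a (h.lt_symm hab) hb ha fun e => absurd (haq.1.trans e.symm) (h.ne hab)

lemma orient
    (h : NestedStep (quasiComplete K R q) G₁) (hRK : R ⊆ K) (hcard : R.card < K.card)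
    (hK : 2 ≤ K.card) {a b : Fin n} (hab : quasiComplete K R q a b < G₁ a b) :
    (a ∉ K ∧ b ∈ K) ∨ (b ∉ K ∧ a ∈ K) := by
  by_cases ha : a ∈ K <;> by_cases hb : b ∈ K
  · exact absurd (h.eq_zero hab) (by
      rw [quasiComplete_clique (h.ne hab) ha hb]; exact one_ne_zero)
  · exact Or.inr ⟨hb, ha⟩
  · exact Or.inl ⟨ha, hb⟩
  · exact absurd (h.mem_or_mem hRK hcard hK hab) (by simp [ha, hb])

/-- At most one link to isolated nodes receives weight. -/
lemma outside_unique
    (h : NestedStep (quasiComplete K R q) G₁) (hRK : R ⊆ K) {v m v' m' : Fin n} (hv : v ∉ K)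
    (hm : m ∈ K) (hv' : v' ∉ K) (hm' : m' ∈ K)
    (hvm : quasiComplete K R q v m < G₁ v m) (hvm' : quasiComplete K R q v' m' < G₁ v' m')
    (hvq : v = q → R = ∅) (hvq' : v' = q → R = ∅) : v = v' ∧ m = m' := by
  have key : v = v' := by
    by_contra hne
    have hmm : m ≠ m' := by
      rintro rfl
      exact hne (h.matching (h.lt_symm hvm) (h.lt_symm hvm'))
    have d : ∀ {x y : Fin n}, x ∉ K → y ∈ K → y ≠ x := fun hx hy e => hx (e ▸ hy)
    refine h.nested v v' m' m hne (d hv hm') (d hv' hm') (d hv hm) (d hv' hm) ?_ (h.pos hvm') ?_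
      (h.pos hvm)
    · rw [h.eq_of_ne_partner hvm hmm, quasiComplete_outside hRK hv fun e => by simp [hvq e]]
      exact one_pos
    · rw [h.eq_of_ne_partner hvm' hmm.symm,
        quasiComplete_outside hRK hv' fun e => by simp [hvq' e]]
      exact one_pos
  subst key
  exact ⟨rfl, h.matching hvm hvm'⟩

/-- Every node outside the clique is isolated, so a single link from the clique to an outside node
takes the whole unit, and that node becomes the new `q`. -/
lemma isQuasiComplete_of_empty
    (h : NestedStep (quasiComplete K R q) G₁) (hRK : R ⊆ K) (hcard : R.card < K.card)
    (hK : 2 ≤ K.card) (hR : R = ∅) :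
    IsQuasiComplete (K.card.choose 2 + R.card + 1) G₁ := by
  obtain ⟨v, m, hv, hm, hvm⟩ : ∃ v m, v ∉ K ∧ m ∈ K ∧ quasiComplete K R q v m < G₁ v m := by
    obtain ⟨a, b, hab⟩ := h.exists_lt
    rcases h.orient hRK hcard hK hab with ⟨h1, h2⟩ | ⟨h1, h2⟩
    · exact ⟨a, b, h1, h2, hab⟩
    · exact ⟨b, a, h1, h2, h.lt_symm hab⟩
  have hne := h.ne hvm
  have e := h.eq_add_link hne fun a b hab => by
    rcases h.orient hRK hcard hK hab with ⟨h1, h2⟩ | ⟨h1, h2⟩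
    · exact Or.inl (h.outside_unique hRK h1 h2 hv hm hab hvm (fun _ => hR) fun _ => hR)
    · exact Or.inr (h.outside_unique hRK h1 h2 hv hm (h.lt_symm hab) hvm (fun _ => hR)
        fun _ => hR).symm
  subst hR
  refine ⟨K, {m}, v, by simpa using hm, fun _ => hv, ?_, ?_, by simp, ?_⟩
  · simp
  · rw [succ_choose_two]; simp; omega
  · intro i j
    rw [e, link_apply hne, quasiComplete]
    simp only [Finset.mem_singleton, Finset.notMem_empty, and_false, false_and, or_false]
    have : v ≠ m := hne
    by_cases h1 : i ≠ j ∧ i ∈ K ∧ j ∈ K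
    · rw [if_pos h1, if_neg, if_pos ⟨h1.1, Or.inl h1.2⟩, add_zero]
      rintro (⟨rfl, rfl⟩ | ⟨rfl, rfl⟩)
      exacts [hv h1.2.1, hv h1.2.2]
    · rw [if_neg h1, zero_add]
      congr 1
      simp only [eq_iff_iff]
      grind

lemma isQuasiComplete_of_last
    (hRK : R ⊆ K) (hq : R.Nonempty → q ∉ K) {k : Fin n} (hR : R.Nonempty) (hkK : k ∈ K)
    (hkR : k ∉ R)
    (e : ∀ a b, G₁ a b = quasiComplete K R q a b + link q k a b) :
    IsQuasiComplete (K.card.choose 2 + R.card + 1) G₁ := by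
  classical
  have hqK := hq hR
  have hqk : q ≠ k := fun e => hqK (e ▸ hkK)
  have hR'K : insert k R ⊆ K := Finset.insert_subset hkK hRK
  have hR'card : (insert k R).card = R.card + 1 := Finset.card_insert_of_notMem hkR
  have hle := Finset.card_le_card hR'K
  have e' : ∀ i j, G₁ i j = if i ≠ j ∧ ((i ∈ K ∧ j ∈ K) ∨ (i = q ∧ j ∈ insert k R) ∨
      (i ∈ insert k R ∧ j = q)) then 1 else 0 := by
    intro i j
    rw [e, link_apply hqk, quasiComplete]
    by_cases h1 : (i = q ∧ j = k) ∨ (i = k ∧ j = q)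
    · rw [if_pos h1, if_neg, if_pos, zero_add]
      · grind
      · grind
    · rw [if_neg h1, add_zero]
      congr 1
      simp only [eq_iff_iff]
      grind
  -- If `k` was the last clique node not linked to `q`, then `q` joins the clique and the set of
  -- remaining links is empty again.
  rcases hle.lt_or_eq with hlt | heq
  · refine ⟨K, insert k R, q, hR'K, fun _ => hqK, ?_, ?_, ?_, fun i j => ?_⟩
    · omega
    · rw [succ_choose_two]; omega
    · omega
    · rw [e']
  · have hR' : insert k R = K := Finset.eq_of_subset_of_card_le hR'K heq.ge
    have hc : (insert q K).card = K.card + 1 := Finset.card_insert_of_notMem hqK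
    have hch : (K.card + 1).choose 2 = K.card + K.card.choose 2 := by
      rw [succ_choose_two]
    have hch' : (K.card + 1 + 1).choose 2 = K.card + 1 + (K.card + 1).choose 2 := by
      rw [succ_choose_two]
    refine ⟨insert q K, ∅, q, by simp, by simp, ?_, ?_, ?_, fun i j => ?_⟩
    · rw [hc]; omega
    · rw [hc]; omega
    · rw [hc, Finset.card_empty]; omega
    · rw [e', hR']
      congr 1
      simp only [eq_iff_iff, Finset.mem_insert, Finset.notMem_empty]
      grind

lemma hasPendant
    (h : NestedStep (quasiComplete K R q) G₁) (hRK : R ⊆ K) (hq : R.Nonempty → q ∉ K)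
    {z m k : Fin n} (hR : R.Nonempty) (hz : z ∉ K) (hzq : z ≠ q) (hm : m ∈ R)
    (hk : k ∈ K) (hkR : k ∉ R) (hzm : quasiComplete K R q z m < G₁ z m)
    (e : ∀ a b, G₁ a b = quasiComplete K R q a b + (1 - G₁ z m) * link q k a b +
      G₁ z m * link z m a b) :
    HasPendant G₁ (G₁ z m) q k z m := by
  have hqK := hq hR
  have hmK := hRK hm
  have d : ∀ {x y : Fin n}, x ∉ K → y ∈ K → x ≠ y := fun hx hy e => hx (e ▸ hy)
  have qk := d hqK hk
  have qm := d hqK hmK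
  have zk := d hz hk
  have zm := d hz hmK
  have km : k ≠ m := fun e => hkR (e ▸ hm)
  have sym0 := fun a b => (h.mem₀ a b).1
  refine ⟨qk, hzq.symm, qm, zk.symm, km, zm, h.pos hzm, (h.mem₁ z m).2.1.2, rfl, ?_, ?_, ?_, ?_,
    ?_, ?_⟩
  · rw [e, quasiComplete_outside hRK hqK fun _ => hkR, link_apply qk, link_apply zm]
    simp [hzq.symm, qm]
  · rw [e, quasiComplete_last qm hm, link_apply qk, link_apply zm]
    simp [hzq.symm, qm, qk, km.symm]
  · rw [e, quasiComplete_clique km hk hmK, link_apply qk, link_apply zm]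
    simp [qk.symm, zk.symm, km, qm.symm]
  · intro l hl
    rw [e, quasiComplete_outside hRK hz fun e => absurd e hzq, link_apply qk, link_apply zm]
    simp [hzq, zk, zm, hl]
  · intro l h1 h2 h3 h4
    rw [e k l, e m l, link_apply qk, link_apply zm, link_apply qk, link_apply zm]
    have : quasiComplete K R q k l = quasiComplete K R q m l := by
      by_cases hl : l ∈ K
      · rw [quasiComplete_clique h2.symm hk hl, quasiComplete_clique h4.symm hmK hl]
      · rw [sym0 k l, sym0 m l, quasiComplete_outside hRK hl fun e => absurd e h1,
          quasiComplete_outside hRK hl fun e => absurd e h1]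
    rw [this]
    simp [h1, h2, h3, h4]
  · intro l hlk hlq
    by_cases hl : l ∈ K
    · refine (h.mem₁ q l).2.1.2.trans ?_
      rw [← quasiComplete_clique (K := K) (R := R) (q := q) hlk.symm hk hl]
      exact h.le k l
    · refine le_trans (le_of_eq ?_) (h.mem₁ k l).2.1.1
      rw [e, quasiComplete_outside hRK hqK fun _ hlR => hl (hRK hlR), link_apply qk,
        link_apply zm]
      simp [qk, qm, hlk, hzq.symm]

/-- A strongly nested network that arises from a quasi-complete graph by adding one unit of weight
is quasi-complete, or has a pendant link. -/
lemma isQuasiComplete_or_hasPendant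
    (h : NestedStep (quasiComplete K R q) G₁) (hRK : R ⊆ K) (hq : R.Nonempty → q ∉ K)
    (hcard : R.card < K.card) (hK : 2 ≤ K.card) :
    IsQuasiComplete (K.card.choose 2 + R.card + 1) G₁ ∨
      ∃ β k z m, HasPendant G₁ β q k z m ∧ quasiComplete K R q z m = 0 := by
  rcases R.eq_empty_or_nonempty with hR | hR
  · exact Or.inl (h.isQuasiComplete_of_empty hRK hcard hK hR)
  have hqK := hq hR
  have d : ∀ {x y : Fin n}, x ∉ K → y ∈ K → x ≠ y := fun hx hy e => hx (e ▸ hy)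
  have hq0 : ∀ {b}, quasiComplete K R q q b < G₁ q b → b ∈ K → b ∉ R := by
    intro b hb hbK hbR
    have := h.eq_zero hb
    rw [quasiComplete_last (d hqK hbK) hbR] at this
    exact one_ne_zero this
  by_cases hz : ∃ z m, z ∉ K ∧ z ≠ q ∧ m ∈ K ∧ quasiComplete K R q z m < G₁ z m
  · right
    obtain ⟨z, m, hzK, hzq, hmK, hzm⟩ := hz
    have hz0 := h.eq_zero hzm
    have hqz : q ≠ z := hzq.symm
    have hqm := d hqK hmK
    have hout : ∀ {v m'}, v ∉ K → m' ∈ K → quasiComplete K R q v m' < G₁ v m' → v ≠ q →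
        v = z ∧ m' = m := fun h1 h2 h3 h4 =>
      h.outside_unique hRK h1 h2 hzK hmK h3 hzm (fun e => absurd e h4)
        fun e => absurd e hzq
    -- If `q` receives weight, `k` is its partner; otherwise `k` is any node of `K \ R`, and the
    -- pendant link has weight one. In both cases `m ∉ R` would make `q` and `z` incomparable.
    obtain ⟨k, hkK, hkR, hmR, huse⟩ : ∃ k, k ∈ K ∧ k ∉ R ∧ m ∈ R ∧
        ∀ b, b ∈ K → quasiComplete K R q q b < G₁ q b → b = k := by
      by_cases hqe : ∃ k, k ∈ K ∧ quasiComplete K R q q k < G₁ q k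
      · obtain ⟨k, hkK, hqk⟩ := hqe
        have hkR := hq0 hqk hkK
        refine ⟨k, hkK, hkR, ?_, fun b _ hb => h.matching hb hqk⟩
        by_contra hmR
        have hmk : m ≠ k := by
          rintro rfl
          exact hqz (h.matching (h.lt_symm hqk) (h.lt_symm hzm))
        refine h.nested q z m k hqz hqm.symm (d hzK hmK).symm (d hqK hkK).symm (d hzK hkK).symm
          ?_ (h.pos hzm) ?_ (h.pos hqk)
        · rw [h.eq_of_ne_partner hqk hmk.symm, quasiComplete_outside hRK hqK fun _ => hmR]
          exact one_pos
        · rw [h.eq_of_ne_partner hzm hmk, quasiComplete_outside hRK hzK fun e => absurd e hzq]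
          exact one_pos
      · push Not at hqe
        obtain ⟨k, hkK, hkR⟩ := Finset.exists_mem_notMem_of_card_lt_card hcard
        refine ⟨k, hkK, hkR, ?_, fun b hbK hb => absurd hb (not_lt.2 (hqe b hbK))⟩
        by_contra hmR
        obtain ⟨y, hy⟩ := hR
        have hyK := hRK hy
        have hmy : m ≠ y := fun e => hmR (e ▸ hy)
        refine h.nested q z m y hqz hqm.symm (d hzK hmK).symm (d hqK hyK).symm (d hzK hyK).symm
          ?_ (h.pos hzm) ?_ ?_
        · refine (hqe m hmK).trans_lt ?_
          rw [quasiComplete_outside hRK hqK fun _ => hmR]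
          exact one_pos
        · rw [h.eq_of_ne_partner hzm hmy, quasiComplete_outside hRK hzK fun e => absurd e hzq]
          exact one_pos
        · refine one_pos.trans_le ?_
          rw [← quasiComplete_last (K := K) (d hqK hyK) hy]
          exact h.le q y
    have hpair : ∀ a b, a ∉ K → b ∈ K → quasiComplete K R q a b < G₁ a b →
        (a = q ∧ b = k) ∨ (a = z ∧ b = m) := by
      intro a b ha hb hab
      by_cases haq : a = q
      · subst haq; exact Or.inl ⟨rfl, huse b hb hab⟩
      · exact Or.inr (hout ha hb hab haq)
    obtain ⟨-, e⟩ := h.eq_add_link_add (d hqK hkK) (d hzK hmK) hqz hqm fun a b hab => by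
      rcases h.orient hRK hcard hK hab with ⟨h1, h2⟩ | ⟨h1, h2⟩
      · have := hpair a b h1 h2 hab
        tauto
      · have := hpair b a h1 h2 (h.lt_symm hab)
        tauto
    rw [hz0, sub_zero] at e
    exact ⟨_, k, z, m, h.hasPendant hRK hq hR hzK hzq hmR hkK hkR hzm e, hz0⟩
  · left
    push Not at hz
    have hall : ∀ a b, a ∉ K → b ∈ K → quasiComplete K R q a b < G₁ a b → a = q := by
      intro a b ha hb hab
      by_contra haq
      exact absurd hab (not_lt.2 (hz a b ha haq hb))
    obtain ⟨k, hkK, hqk⟩ : ∃ k, k ∈ K ∧ quasiComplete K R q q k < G₁ q k := by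
      obtain ⟨a, b, hab⟩ := h.exists_lt
      rcases h.orient hRK hcard hK hab with ⟨h1, h2⟩ | ⟨h1, h2⟩
      · obtain rfl := hall a b h1 h2 hab
        exact ⟨b, h2, hab⟩
      · have hba := h.lt_symm hab
        obtain rfl := hall b a h1 h2 hba
        exact ⟨a, h2, hba⟩
    refine isQuasiComplete_of_last hRK hq hR hkK (hq0 hqk hkK)
      (h.eq_add_link (d hqK hkK) fun a b hab => ?_)
    rcases h.orient hRK hcard hK hab with ⟨h1, h2⟩ | ⟨h1, h2⟩
    · obtain rfl := hall a b h1 h2 hab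
      exact Or.inl ⟨rfl, h.matching hab hqk⟩
    · have hba := h.lt_symm hab
      obtain rfl := hall b a h1 h2 hba
      exact Or.inr ⟨h.matching hba hqk, rfl⟩

end NestedStep

end QuasiComplete

lemma IsQuasiComplete.succ_or_hasPendant {t : ℕ} (h₀ : IsQuasiComplete t G₀)
    (m₀ : G₀ ∈ weightedNetworks n) (m₁ : G₁ ∈ weightedNetworks n) (hle : ∀ i j, G₀ i j ≤ G₁ i j)
    (hsum : ∑ i, ∑ j, G₁ i j = (∑ i, ∑ j, G₀ i j) + 2) (hn : StronglyNested G₁) :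
    IsQuasiComplete (t + 1) G₁ ∨
      ∃ β q k z m, HasPendant G₁ β q k z m ∧ G₀ z m = 0 := by
  obtain ⟨K, R, q, hRK, hq, hKt, htK, htR, hG₀⟩ := h₀
  obtain rfl : G₀ = quasiComplete K R q := by
    ext i j; rw [hG₀]; rfl
  have h : NestedStep (quasiComplete K R q) G₁ :=
    ⟨m₀, m₁, quasiComplete_zero_or_one, hle, hsum, hn⟩
  rw [succ_choose_two] at htK
  have hcard : R.card < K.card := by omega
  -- A clique of one node means the empty network at `t = 0`. The general argument needs a clique
  -- link, so the first step is treated separately.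
  rcases Nat.lt_or_ge K.card 2 with hK | hK
  · left
    have hK1 : K.card = 1 := by omega
    have hR : R = ∅ := Finset.card_eq_zero.1 (by omega)
    obtain ⟨x, rfl⟩ := Finset.card_eq_one.1 hK1
    subst hR
    have ht : t = 0 := by rw [← htR]; simp
    rw [ht]
    refine h.isQuasiComplete_of_zero fun a b => ?_
    simp only [quasiComplete, Finset.mem_singleton, Finset.notMem_empty, and_false, false_and,
      or_false]
    rw [if_neg]
    rintro ⟨h1, h2, h3⟩
    exact h1 (h2.trans h3.symm)
  · rcases h.isQuasiComplete_or_hasPendant hRK hq hcard hK with h1 | ⟨β, k, z, m, h1⟩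
    · left; rwa [htR] at h1
    · exact Or.inr ⟨β, q, k, z, m, h1⟩

lemma isQuasiComplete_zero (x : Fin n) : IsQuasiComplete 0 (0 : Network n) := by
  refine ⟨{x}, ∅, x, by simp, by simp, by simp, by simp, by simp, fun i j => ?_⟩
  rw [if_neg]
  · rfl
  · simp only [Finset.mem_singleton, Finset.notMem_empty, and_false, false_and, or_false]
    rintro ⟨h1, h2, h3⟩
    exact h1 (h2.trans h3.symm)

end SeqNet

/-! ### Moving a link along a path, and the Lipschitz bound. -/

namespace SeqNet

variable {n T : ℕ} {φ : ℝ} {G G' : Network n}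

/-- Move as much weight as fits from the link `zm` to the link `qk`. -/
def moveLink (q k z m : Fin n) (G : Network n) : Network n :=
  G + min (1 - G q k) (G z m) • (link q k - link z m)

section MoveLink

variable {q k z m : Fin n}

lemma moveLink_apply (hqk : q ≠ k) (hzm : z ≠ m) (hqz : q ≠ z) (hqm : q ≠ m)
    (hG : G ∈ weightedNetworks n) (a b : Fin n) :
    moveLink q k z m G a b =
      if (a = q ∧ b = k) ∨ (a = k ∧ b = q) then min 1 (G q k + G z m)
      else if (a = z ∧ b = m) ∨ (a = m ∧ b = z) then max 0 (G q k + G z m - 1) else G a b := by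
  have e : moveLink q k z m G a b =
      G a b + min (1 - G q k) (G z m) * (link q k a b - link z m a b) := by
    simp [moveLink]
  rw [e, link_apply hqk, link_apply hzm]
  by_cases h1 : (a = q ∧ b = k) ∨ (a = k ∧ b = q)
  · have h2 : ¬ ((a = z ∧ b = m) ∨ (a = m ∧ b = z)) := by grind
    have h3 : G a b = G q k := by
      rcases h1 with ⟨rfl, rfl⟩ | ⟨rfl, rfl⟩
      exacts [rfl, (hG _ _).1]
    rw [if_pos h1, if_neg h2, if_pos h1, h3, sub_zero, mul_one, ← min_add_add_left]
    congr 1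
    ring
  · rw [if_neg h1, if_neg h1]
    split_ifs with h2
    · have h3 : G a b = G z m := by
        rcases h2 with ⟨rfl, rfl⟩ | ⟨rfl, rfl⟩
        exacts [rfl, (hG _ _).1]
      rw [h3]
      rcases le_total (1 - G q k) (G z m) with h | h
      · rw [min_eq_left h, max_eq_right (by linarith)]; ring
      · rw [min_eq_right h, max_eq_left (by linarith)]; ring
    · ring

/-- As for compression, the two new weights are monotone functions of `g_qk + g_zm`, so truncation
at full weight preserves feasibility. -/
lemma moveLink_feasible (hqk : q ≠ k) (hzm : z ≠ m) (hqz : q ≠ z) (hqm : q ≠ m)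
    {s : ℕ → Network n} (hs : s ∈ feasiblePaths n T) :
    (fun t => moveLink q k z m (s t)) ∈ feasiblePaths n T := by
  refine feasible_comp ?_ (fun G hG a b => ?_) (fun G hG G' hG' hle a b => ?_) (fun G => ?_) hs
  · simp [moveLink]
  · have hs : ∀ a b, moveLink q k z m G a b = moveLink q k z m G b a := by
      intro a b
      simp only [moveLink, Matrix.add_apply, Matrix.smul_apply, Matrix.sub_apply]
      rw [(hG a b).1, link_symm q k a, link_symm z m a]
    refine ⟨hs a b, ?_, ?_⟩
    · rw [moveLink_apply hqk hzm hqz hqm hG]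
      have h1 := (hG q k).2.1
      have h2 := (hG z m).2.1
      split_ifs
      · exact ⟨le_min zero_le_one (add_nonneg h1.1 h2.1), min_le_left _ _⟩
      · exact ⟨le_max_left _ _, max_le zero_le_one (by linarith [h1.2, h2.2])⟩
      · exact (hG a b).2.1
    · rw [moveLink_apply hqk hzm hqz hqm hG, if_neg, if_neg]
      · exact (hG a a).2.2
      · rintro (⟨rfl, h⟩ | ⟨rfl, h⟩)
        exacts [hzm h, hzm h.symm]
      · rintro (⟨rfl, h⟩ | ⟨rfl, h⟩)
        exacts [hqk h, hqk h.symm]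
  · rw [moveLink_apply hqk hzm hqz hqm hG, moveLink_apply hqk hzm hqz hqm hG']
    have := add_le_add (hle q k) (hle z m)
    split_ifs
    · exact min_le_min_left _ this
    · exact max_le_max_left _ (sub_le_sub_right this 1)
    · exact hle a b
  · simp only [moveLink, Matrix.add_apply, Matrix.smul_apply, Matrix.sub_apply, smul_eq_mul,
      Finset.sum_add_distrib, ← Finset.mul_sum, Finset.sum_sub_distrib, sum_sum_link, sub_self,
      mul_zero, add_zero]

lemma abs_moveLink_sub_le (hqk : q ≠ k) (hzm : z ≠ m) (hG : G ∈ weightedNetworks n) {β : ℝ}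
    (hβ : 1 - G q k ≤ β) (a b : Fin n) : |moveLink q k z m G a b - G a b| ≤ β := by
  have h0 : 0 ≤ min (1 - G q k) (G z m) := le_min (sub_nonneg.2 (hG q k).2.1.2) (hG z m).2.1.1
  have e : moveLink q k z m G a b - G a b =
      min (1 - G q k) (G z m) * (link q k a b - link z m a b) := by
    simp [moveLink]
  rw [e, abs_mul, abs_of_nonneg h0]
  have : |link q k a b - link z m a b| ≤ 1 := by
    rw [link_apply hqk, link_apply hzm]
    split_ifs <;> norm_num
  calc _ ≤ min (1 - G q k) (G z m) * 1 := mul_le_mul_of_nonneg_left this h0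
    _ ≤ β := by rw [mul_one]; exact (min_le_left _ _).trans hβ

lemma moveLink_eq_self (hG : G ∈ weightedNetworks n) (h : G z m = 0) :
    moveLink q k z m G = G := by
  have : min (1 - G q k) (G z m) = 0 := by
    rw [h]; exact min_eq_right (sub_nonneg.2 (hG q k).2.1.2)
  simp [moveLink, this]

end MoveLink

lemma HasPendant.moveLink_eq {β : ℝ} {q k z m : Fin n} (hp : HasPendant G β q k z m) :
    moveLink q k z m G = G + β • (link q k - link z m) := by
  rw [moveLink, hp.weight_qk, hp.weight_zm, sub_sub_cancel, min_self]

namespace Subcritical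

/-- Each centrality changes by at most `φ(nβM)M`; the difference of squares adds a factor `2M`, and
the sum over nodes a factor `n`. Linearity in `β` is what the discounting argument needs. -/
lemma abs_kbSq_sub_le (h : Subcritical φ G) (h' : Subcritical φ G') {β M : ℝ}
    (hM : ∀ i, kb φ G i ≤ M) (hM' : ∀ i, kb φ G' i ≤ M) (hβ : ∀ i j, |G' i j - G i j| ≤ β) :
    |kbSq φ G' - kbSq φ G| ≤ 2 * φ * n ^ 2 * M ^ 3 * β := by
  rcases isEmpty_or_nonempty (Fin n) with he | ⟨⟨x⟩⟩
  · have : n = 0 := by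
      rcases Nat.eq_zero_or_pos n with h | h
      · exact h
      · exact he.elim ⟨0, h⟩
    subst this
    simp [kbSq]
  have hM0 : 0 ≤ M := (h.kb_nonneg x).trans (hM x)
  have hβ0 : 0 ≤ β := (abs_nonneg _).trans (hβ x x)
  have hη : ∀ i, |∑ j, (G' i j - G i j) * kb φ G j| ≤ n * (β * M) := by
    intro i
    refine (Finset.abs_sum_le_sum_abs _ _).trans ?_
    have : ∀ j ∈ (Finset.univ : Finset (Fin n)), |(G' i j - G i j) * kb φ G j| ≤ β * M := by
      intro j _
      rw [abs_mul, abs_of_nonneg (h.kb_nonneg j)]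
      exact mul_le_mul (hβ i j) (hM j) (h.kb_nonneg j) hβ0
    simpa using Finset.sum_le_card_nsmul _ _ _ this
  have hsq : ∀ i ∈ (Finset.univ : Finset (Fin n)),
      |kb φ G' i ^ 2 - kb φ G i ^ 2| ≤ φ * (n * (β * M)) * M * (2 * M) := by
    intro i _
    have h1 := h.abs_kb_sub_le h' hη i
    have hφη : 0 ≤ φ * (n * (β * M)) := mul_nonneg h.pos.le (by positivity)
    have h2 : |kb φ G' i - kb φ G i| ≤ φ * (n * (β * M)) * M :=
      h1.trans (mul_le_mul_of_nonneg_left (hM' i) hφη)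
    rw [sq_sub_sq, abs_mul, mul_comm,
      abs_of_nonneg (add_nonneg (h'.kb_nonneg i) (h.kb_nonneg i))]
    exact mul_le_mul h2 (by linarith [hM i, hM' i])
      (add_nonneg (h'.kb_nonneg i) (h.kb_nonneg i)) (mul_nonneg hφη hM0)
  have hdef : kbSq φ G' - kbSq φ G = ∑ i, (kb φ G' i ^ 2 - kb φ G i ^ 2) := by
    simp [kbSq]
  rw [hdef]
  refine (Finset.abs_sum_le_sum_abs _ _).trans ((Finset.sum_le_card_nsmul _ _ _ hsq).trans
    (le_of_eq ?_))
  simp only [Finset.card_univ, Fintype.card_fin, nsmul_eq_mul]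
  ring

lemma kb_eq_adjugate (h : Subcritical φ G) (i : Fin n) :
    kb φ G i = (1 - φ • G).det⁻¹ * ((1 - φ • G).adjugate.mulVec 1) i := by
  have h1 : (1 - φ • G).mulVec (kb φ G) = 1 := by
    ext j
    have := h.kb_eq j
    rw [Matrix.sub_mulVec, Matrix.one_mulVec, Matrix.smul_mulVec, Pi.sub_apply, Pi.smul_apply,
      smul_eq_mul, Pi.one_apply]
    simp only [Matrix.mulVec, dotProduct]
    linarith
  rw [← h1, Matrix.mulVec_mulVec, Matrix.adjugate_mul, Matrix.smul_mulVec, Matrix.one_mulVec,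
    Pi.smul_apply, smul_eq_mul, inv_mul_cancel_left₀ h.posDef.det_pos.ne']

end Subcritical

/-! ### Compactness of the set of paths and a uniform bound on centralities. -/

lemma continuous_path_apply (t : ℕ) (i j : Fin n) :
    Continuous fun s : ℕ → Network n => s t i j :=
  (continuous_apply j).comp ((continuous_apply i).comp (continuous_apply t))

lemma isCompact_weightedNetworks : IsCompact (weightedNetworks n) := by
  have hK : IsCompact (Set.univ.pi fun _ : Fin n => Set.univ.pi fun _ : Fin n =>
      Set.Icc (0 : ℝ) 1) :=
    isCompact_univ_pi fun _ => isCompact_univ_pi fun _ => isCompact_Icc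
  have hc : ∀ i j, Continuous fun G : Network n => G i j := fun i j =>
    (continuous_apply j).comp (continuous_apply i)
  refine IsCompact.of_isClosed_subset hK ?_ fun G hG i _ j _ => (hG i j).2.1
  simp only [weightedNetworks, Set.ofPred_forall, Set.ofPred_and]
  exact isClosed_iInter fun i => isClosed_iInter fun j =>
    (isClosed_eq (hc i j) (hc j i)).inter ((isClosed_Icc.preimage (hc i j)).inter
      (isClosed_eq (hc i i) continuous_const))

/-- Feasibility leaves the values after `T` free, so they are confined to weighted networks here;
Tychonoff's theorem then applies. -/
lemma isCompact_feasiblePaths :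
    IsCompact {s | s ∈ feasiblePaths n T ∧ ∀ t, s t ∈ weightedNetworks n} := by
  have hK : IsCompact (Set.univ.pi fun _ : ℕ => weightedNetworks n) :=
    isCompact_univ_pi fun _ => isCompact_weightedNetworks
  have e : {s | s ∈ feasiblePaths n T ∧ ∀ t, s t ∈ weightedNetworks n} =
      (Set.univ.pi fun _ : ℕ => weightedNetworks n) ∩ ({s | s 0 = 0} ∩
        {s | ∀ t ∈ Finset.Icc 1 T, (∀ i j, s (t - 1) i j ≤ s t i j) ∧
          ∑ i, ∑ j, s t i j = (∑ i, ∑ j, s (t - 1) i j) + 2}) := by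
    ext s
    constructor
    · rintro ⟨hs, hm⟩
      exact ⟨fun t _ => hm t, hs.1, fun t ht => ((mem_successors_iff (hm _)).1 (hs.2 t ht)).2⟩
    · rintro ⟨hm, h0, hs⟩
      have hm' : ∀ t, s t ∈ weightedNetworks n := fun t => hm t trivial
      exact ⟨⟨h0, fun t ht => (mem_successors_iff (hm' _)).2 ⟨hm' t, hs t ht⟩⟩, hm'⟩
  rw [e]
  refine hK.inter_right ((isClosed_eq (continuous_apply 0) continuous_const).inter ?_)
  have hsum : ∀ t, Continuous fun s : ℕ → Network n => ∑ i, ∑ j, s t i j := fun t =>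
    continuous_finsetSum _ fun i _ => continuous_finsetSum _ fun j _ => continuous_path_apply t i j
  simp only [Set.ofPred_forall, Set.ofPred_and]
  exact isClosed_iInter fun t => isClosed_iInter fun _ =>
    (isClosed_iInter fun i => isClosed_iInter fun j =>
      isClosed_le (continuous_path_apply _ i j) (continuous_path_apply _ i j)).inter
      (isClosed_eq (hsum t) ((hsum (t - 1)).add continuous_const))

/-- The centralities are bounded uniformly on the networks that can be formed. -/
lemma exists_kb_le (hsub : ∀ s ∈ feasiblePaths n T, ∀ t ∈ Finset.Icc 1 T, Subcritical φ (s t)) :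
    ∃ M : ℝ, 0 ≤ M ∧ ∀ s ∈ feasiblePaths n T, ∀ t ∈ Finset.Icc 1 T, ∀ i, kb φ (s t) i ≤ M := by
  have key : ∀ t i, ∃ C : ℝ, t ∈ Finset.Icc 1 T → ∀ s ∈ feasiblePaths n T, kb φ (s t) i ≤ C := by
    intro t i
    by_cases ht : t ∈ Finset.Icc 1 T
    · have hA : Continuous fun s : ℕ → Network n => 1 - φ • s t :=
        continuous_const.sub ((continuous_apply t).const_smul φ)
      have hcont : ContinuousOn (fun s : ℕ → Network n => kb φ (s t) i)
          {s | s ∈ feasiblePaths n T ∧ ∀ t, s t ∈ weightedNetworks n} := by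
        -- Cramer's rule makes continuity evident, the determinant being positive on feasible paths.
        refine ContinuousOn.congr (f := fun s : ℕ → Network n =>
          (1 - φ • s t).det⁻¹ * ((1 - φ • s t).adjugate.mulVec 1) i) ?_
          (fun s hs => (hsub s hs.1 t ht).kb_eq_adjugate i)
        refine ContinuousOn.mul (hA.matrix_det.continuousOn.inv₀ fun s hs =>
          (hsub s hs.1 t ht).posDef.det_pos.ne') ?_
        exact ((continuous_apply i).comp
          (hA.matrix_adjugate.matrix_mulVec continuous_const)).continuousOn
      obtain ⟨C, hC⟩ := isCompact_feasiblePaths.exists_bound_of_continuousOn hcont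
      refine ⟨C, fun _ s hs => ?_⟩
      -- the values of the path after `T` play no role
      have hs' : (fun r => if r ≤ T then s r else 0) ∈ feasiblePaths n T := by
        refine ⟨by simpa using hs.1, fun r hr => ?_⟩
        have := (Finset.mem_Icc.1 hr).2
        simp only [this, (Nat.sub_le r 1).trans this, if_true]
        exact hs.2 r hr
      have := hC _ ⟨hs', fun r => by
        split_ifs with h
        · exact mem_weightedNetworks_of_feasible hs h
        · exact zero_mem_weightedNetworks⟩
      simp only [(Finset.mem_Icc.1 ht).2, if_true] at this
      exact (le_abs_self _).trans this
    · exact ⟨0, fun h => absurd h ht⟩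
  choose C hC using key
  refine ⟨∑ t ∈ Finset.Icc 1 T, ∑ i, |C t i|, Finset.sum_nonneg fun t _ =>
    Finset.sum_nonneg fun i _ => abs_nonneg _, fun s hs t ht i => ?_⟩
  calc kb φ (s t) i ≤ |C t i| := (hC t i ht s hs).trans (le_abs_self _)
    _ ≤ ∑ i, |C t i| := Finset.single_le_sum (f := fun i => |C t i|)
        (fun _ _ => abs_nonneg _) (Finset.mem_univ i)
    _ ≤ _ := Finset.single_le_sum (f := fun t => ∑ i, |C t i|)
        (fun _ _ => Finset.sum_nonneg fun _ _ => abs_nonneg _) ht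

/-! ### Optimal paths under myopia and under strong discounting. -/

/-- A feasible path of strongly nested networks without pendant links consists of quasi-complete
networks. -/
lemma isQuasiComplete_of_stronglyNested {s : ℕ → Network n} (hs : s ∈ feasiblePaths n T)
    (hn : ∀ t ∈ Finset.Icc 1 T, StronglyNested (s t))
    (hp : ∀ t ∈ Finset.Icc 1 T, ∀ β q k z m, HasPendant (s t) β q k z m →
      s (t - 1) z m = 0 → False) :
    ∀ t ∈ Finset.Icc 1 T, IsQuasiComplete t (s t) := by
  intro t ht
  obtain ⟨h1, hT⟩ := Finset.mem_Icc.1 ht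
  have hstep1 := feasible_step hs (t := 0) (by omega)
  obtain ⟨x⟩ : Nonempty (Fin n) := by
    by_contra hc
    rw [not_nonempty_iff] at hc
    have := hstep1.2
    simp at this
  have key : ∀ t, t ≤ T → IsQuasiComplete t (s t) := by
    intro t
    induction t with
    | zero => intro _; rw [hs.1]; exact isQuasiComplete_zero x
    | succ t ih =>
      intro hT
      have ht : t + 1 ∈ Finset.Icc 1 T := Finset.mem_Icc.2 ⟨by omega, hT⟩
      obtain ⟨hle, hsum⟩ := feasible_step hs hT
      rcases (ih (by omega)).succ_or_hasPendant
        (mem_weightedNetworks_of_feasible hs (by omega)) (mem_weightedNetworks_of_feasible hs hT)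
        hle hsum (hn _ ht) with h | ⟨β, q, k, z, m, h1, h2⟩
      · exact h
      · exact (hp _ ht β q k z m h1 (by simpa using h2)).elim
  exact key t hT

lemma IsSolution.unimprovable {D : ℕ → ℝ} (hD : ∀ t ∈ Finset.Icc 1 T, 0 ≤ D t)
    {s : ℕ → Network n} (hs : IsSolution φ T D s) {t : ℕ} (ht : t ∈ Finset.Icc 1 T)
    (hDt : 0 < D t) : Unimprovable φ T s t := by
  intro s' hs' hle hlt
  have hopt : payoff φ T D s' ≤ payoff φ T D s := hs.2 hs'
  refine absurd hopt (not_le.2 ?_)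
  exact Finset.sum_lt_sum (fun r hr => mul_le_mul_of_nonneg_left (hle r hr) (hD r hr))
    ⟨t, ht, mul_lt_mul_of_pos_left hlt hDt⟩

/-- Moving the weight of a pendant link leaves the earlier periods unchanged, is profitable when
the link is formed, and later changes the weights by no more than the weight of the link. -/
lemma HasPendant.path_improvement
    (hsub : ∀ s ∈ feasiblePaths n T, ∀ t ∈ Finset.Icc 1 T, Subcritical φ (s t))
    {s : ℕ → Network n} (hs : s ∈ feasiblePaths n T) {t : ℕ} (ht : t ∈ Finset.Icc 1 T)
    {β : ℝ} {q k z m : Fin n} (hp : HasPendant (s t) β q k z m) (h0 : s (t - 1) z m = 0) :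
    ∃ s' ∈ feasiblePaths n T, (∀ r < t, s' r = s r) ∧
      kbSq φ (s t) + φ ^ 3 / (1 + φ) * β ≤ kbSq φ (s' t) ∧
      ∀ r, t ≤ r → r ≤ T → ∀ i j, |s' r i j - s r i j| ≤ β := by
  have hf := moveLink_feasible hp.qk hp.zm hp.qz hp.qm hs
  have hT := (Finset.mem_Icc.1 ht).2
  refine ⟨_, hf, fun r hr => ?_, ?_, fun r hr hrT i j => ?_⟩
  · have hm := mem_weightedNetworks_of_feasible hs (t := r) (by omega)
    refine moveLink_eq_self hm (le_antisymm ?_ (hm z m).2.1.1)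
    rw [← h0]
    exact feasible_mono hs (by omega) (by omega) z m
  · exact hp.kbSq_add_le (hsub s hs t ht) (hsub _ hf t ht) hp.moveLink_eq
  -- The room left on `qk` is `β` at time `t` and only shrinks later, which caps the weight moved in
  -- every later period.
  · refine abs_moveLink_sub_le hp.qk hp.zm (mem_weightedNetworks_of_feasible hs hrT) ?_ i j
    have := feasible_mono hs hr hrT q k
    rw [hp.weight_qk] at this
    linarith

/-- A path that is nowhere worse and somewhere better is preferred, by looking at the first strict
gain; this gives strong nestedness. Moving a pendant link may hurt later, but the first period
affected is a gain. -/
lemma isQuasiComplete_of_myopic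
    (hsub : ∀ s ∈ feasiblePaths n T, ∀ t ∈ Finset.Icc 1 T, Subcritical φ (s t))
    {pref : (ℕ → Network n) → (ℕ → Network n) → Prop} (hpref : IsMyopic φ T pref)
    {s : ℕ → Network n} (hs : s ∈ feasiblePaths n T)
    (hmax : ∀ s' ∈ feasiblePaths n T, ¬ pref s' s) :
    ∀ t ∈ Finset.Icc 1 T, IsQuasiComplete t (s t) := by
  have hu : ∀ t ∈ Finset.Icc 1 T, Unimprovable φ T s t := by
    intro t ht s' hs' hle hlt
    have hex : ∃ t, t ∈ Finset.Icc 1 T ∧ kbSq φ (s t) < kbSq φ (s' t) := ⟨t, ht, hlt⟩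
    classical
    obtain ⟨h1, h2⟩ := Nat.find_spec hex
    refine hmax s' hs' (hpref s' hs' s hs _ h1 (fun r hr hlt => ?_) h2)
    have := Nat.find_min hex hlt
    push Not at this
    exact le_antisymm (this hr) (hle r hr)
  refine isQuasiComplete_of_stronglyNested hs (fun t ht => (hu t ht).stronglyNested hsub hs ht) ?_
  intro t ht β q k z m hp h0
  obtain ⟨s', hs', h1, h2, -⟩ := hp.path_improvement hsub hs ht h0
  refine hmax s' hs' (hpref s' hs' s hs t ht (fun r _ hr => by rw [h1 r hr]) ?_)
  have := (hsub s hs t ht).pos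
  have : 0 < φ ^ 3 / (1 + φ) * β := mul_pos (by positivity) hp.pos
  linarith

/-- Moving a pendant link gains at least `D t · cβ` in period `t` and loses at most `εD t · Lβ` in
each later period. The factor `β` cancels, so `εTL < c` suffices whatever the path. -/
lemma isQuasiComplete_of_discount (hφ : 0 < φ)
    (hsub : ∀ s ∈ feasiblePaths n T, ∀ t ∈ Finset.Icc 1 T, Subcritical φ (s t)) :
    ∃ ε : ℝ, 0 < ε ∧ ∀ D : ℕ → ℝ, (∀ t ∈ Finset.Icc 1 T, D t ∈ Set.Ioc (0 : ℝ) 1) →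
      (∀ t ∈ Finset.Icc 1 T, t + 1 ≤ T → D (t + 1) / D t < ε) →
      ∀ s : ℕ → Network n, IsSolution φ T D s →
        ∀ t ∈ Finset.Icc 1 T, IsQuasiComplete t (s t) := by
  obtain ⟨M, hM0, hM⟩ := exists_kb_le hsub
  obtain ⟨c, hc⟩ : ∃ c, c = φ ^ 3 / (1 + φ) := ⟨_, rfl⟩
  obtain ⟨L, hL⟩ : ∃ L, L = 2 * φ * n ^ 2 * M ^ 3 := ⟨_, rfl⟩
  have hc0 : 0 < c := by rw [hc]; positivity
  have hL0 : 0 ≤ L := by rw [hL]; positivity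
  have hTL : 0 < T * L + 1 := by positivity
  -- The bound by 1 makes `D` nonincreasing, so `D r ≤ εD t` for all `r > t`. The summand `+ 1`
  -- covers the case `T * L = 0`.
  have hε0 : 0 < min 1 (c / (T * L + 1)) := lt_min one_pos (div_pos hc0 hTL)
  refine ⟨min 1 (c / (T * L + 1)), hε0, fun D hD hratio s hsol => ?_⟩
  obtain ⟨ε, hε⟩ : ∃ ε, ε = min 1 (c / (T * L + 1)) := ⟨_, rfl⟩
  rw [← hε] at hratio hε0
  have hε1 : ε ≤ 1 := hε ▸ min_le_left _ _
  have hεc : ε * (T * L) < c := by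
    have h1 : ε * (T * L + 1) ≤ c := by
      rw [← le_div_iff₀ hTL]; exact hε ▸ min_le_right _ _
    linarith
  have hs := hsol.1
  have hDpos : ∀ t ∈ Finset.Icc 1 T, 0 < D t := fun t ht => (hD t ht).1
  have hDlater : ∀ t ∈ Finset.Icc 1 T, ∀ r, t + 1 ≤ r → r ≤ T → D r ≤ ε * D t := by
    intro t ht r hr
    have hstep : ∀ u ∈ Finset.Icc 1 T, u + 1 ≤ T → D (u + 1) ≤ ε * D u := fun u hu hu1 =>
      ((div_lt_iff₀ (hDpos u hu)).1 (hratio u hu hu1)).le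
    induction r, hr using Nat.le_induction with
    | base => exact hstep t ht
    | succ r hr ih =>
      intro hrT
      have hr' : r ∈ Finset.Icc 1 T := Finset.mem_Icc.2 ⟨by omega, by omega⟩
      exact (hstep r hr' hrT).trans ((mul_le_of_le_one_left (hDpos r hr').le hε1).trans
        (ih (by omega)))
  refine isQuasiComplete_of_stronglyNested hs (fun t ht =>
    (hsol.unimprovable (fun t ht => (hDpos t ht).le) ht (hDpos t ht)).stronglyNested hsub hs ht) ?_
  intro t ht β q k z m hp h0
  obtain ⟨s', hs', h1, h2, h3⟩ := hp.path_improvement hsub hs ht h0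
  rw [← hc] at h2
  have hβ := hp.pos
  have hDt := hDpos t ht
  have hloss : 0 ≤ ε * D t * (L * β) := by positivity
  -- The loss is charged to every period, including those up to `t`, so that the total is simply `T`
  -- times the same amount.
  have hterm : ∀ r ∈ Finset.Icc 1 T, (if r = t then D t * (c * β) else 0) - ε * D t * (L * β) ≤
      D r * kbSq φ (s' r) - D r * kbSq φ (s r) := by
    intro r hr
    rcases lt_trichotomy r t with hrt | rfl | hrt
    · rw [if_neg hrt.ne, h1 r hrt]
      linarith
    · rw [if_pos rfl]
      have := mul_le_mul_of_nonneg_left h2 hDt.le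
      linarith
    · rw [if_neg hrt.ne']
      have hrT := (Finset.mem_Icc.1 hr).2
      have hlip := (hsub s hs r hr).abs_kbSq_sub_le (hsub s' hs' r hr) (hM s hs r hr)
        (hM s' hs' r hr) (h3 r hrt.le hrT)
      rw [← hL] at hlip
      have hlip' := (abs_le.1 hlip).1
      have hDr := hDlater t ht r hrt hrT
      have h4 := mul_le_mul_of_nonneg_left hlip' (hDpos r hr).le
      have h5 := mul_le_mul_of_nonneg_right hDr (mul_nonneg hL0 hβ.le)
      linarith
  have hsum := Finset.sum_le_sum hterm
  rw [Finset.sum_sub_distrib, Finset.sum_sub_distrib, Finset.sum_ite_eq' _ t, if_pos ht,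
    Finset.sum_const, Nat.card_Icc, Nat.add_sub_cancel, nsmul_eq_mul] at hsum
  have hopt : payoff φ T D s' ≤ payoff φ T D s := hsol.2 hs'
  unfold payoff at hopt
  have := mul_pos (mul_pos hDt hβ) (sub_pos.2 hεc)
  linarith

end SeqNet

theorem proposition2 (n T : ℕ) (φ : ℝ) (hφ : 0 < φ)
    -- the decay parameter is below the reciprocal of the largest eigenvalue, `φ < 1 / λ_max(G)`,
    -- for every network `G` that can be formed within the `T` periods
    (hspec : ∀ s ∈ SeqNet.feasiblePaths n T, ∀ t ∈ Finset.Icc 1 T,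
      ∀ ev ∈ spectrum ℝ (s t), φ * ev < 1) :
    -- (i) every discount function and every solution
    (∀ D : ℕ → ℝ, (∀ t ∈ Finset.Icc 1 T, D t ∈ Set.Icc (0 : ℝ) 1) →
      ∀ s : ℕ → SeqNet.Network n, SeqNet.IsSolution φ T D s → ∀ t ∈ Finset.Icc 1 T, 0 < D t →
        SeqNet.IsWeightedNSG (s t) ∧
        ∀ i j k : Fin n, j ≠ k →
          ¬ (s t i j ∈ Set.Ioo (0 : ℝ) 1 ∧ s t i k ∈ Set.Ioo (0 : ℝ) 1)) ∧
    -- (ii) myopic (lexicographic) preferences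
    (∀ pref : (ℕ → SeqNet.Network n) → (ℕ → SeqNet.Network n) → Prop,
      SeqNet.IsMyopic φ T pref →
      ∀ s ∈ SeqNet.feasiblePaths n T, (∀ s' ∈ SeqNet.feasiblePaths n T, ¬ pref s' s) →
        ∀ t ∈ Finset.Icc 1 T, SeqNet.IsQuasiComplete t (s t)) ∧
    -- (ii) sufficiently strong discounting
    (∃ ε : ℝ, 0 < ε ∧ ∀ D : ℕ → ℝ,
      (∀ t ∈ Finset.Icc 1 T, D t ∈ Set.Ioc (0 : ℝ) 1) →
      (∀ t ∈ Finset.Icc 1 T, t + 1 ≤ T → D (t + 1) / D t < ε) →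
      ∀ s : ℕ → SeqNet.Network n, SeqNet.IsSolution φ T D s →
        ∀ t ∈ Finset.Icc 1 T, SeqNet.IsQuasiComplete t (s t)) := by

  have hsub : ∀ s ∈ SeqNet.feasiblePaths n T, ∀ t ∈ Finset.Icc 1 T, SeqNet.Subcritical φ (s t) :=
    fun s hs t ht => ⟨hφ, (hs.2 t ht).1, hspec s hs t ht⟩
  refine ⟨fun D hD s hs t ht hDt => ?_, fun pref hpref s hs hmax =>
    SeqNet.isQuasiComplete_of_myopic hsub hpref hs hmax,
    SeqNet.isQuasiComplete_of_discount hφ hsub⟩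
  have hn := (hs.unimprovable (fun t ht => (hD t ht).1) ht hDt).stronglyNested hsub hs.1 ht
  have hm := (hs.1.2 t ht).1
  exact ⟨hn.isWeightedNSG hm, fun i j k hjk => hn.not_two_fractional hm hjk⟩
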